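/- Permutations are written in one-line notation. For a finite set $B$ of permutations, $\operatorname{Av}(B)$ is the set of permutations containing no element of $B$ (as a subsequence up to order isomorphism). A permutation $\pi$ of length $n$ is sum indecomposable if there is no $1\le i\le n-1$ with $\pi(\{1,\dots,i\})=\{1,\dots,i\}$. A configuration is a permutation together with zero or more entries $\diamond$ (slots), no two of them adjacent. A new maximum $m$ can be inserted into the $i$th slot from the left by replacing this $\diamond$ with $\diamond m\diamond$, $m\diamond$, $\diamond m$ or $m$; these four operations are the letters $\mathbf m_i,\mathbf l_i,\mathbf r_i,\mathbf f_i$. The insertion encoding of a set $\mathcal C$ of permutations is the language of all words in these letters that lead from the initial configuration $\diamond$ to an element of $\mathcal C$ (a slotless configuration). A configuration is valid for $\operatorname{Av}(B)$ if some word leads from it to an element of $\operatorname{Av}(B)$. For an entry $c(i)$ of a configuration $c$, let $\operatorname{st}(c-c(i))$ be the configuration obtained by deleting $c(i)$ (two slots that become adjacent merge into one) and standardizing the numbers. The entry $c(i)$ is IE-reducible (relative to $B$) if exactly the same words lead from $c$ and from $\operatorname{st}(c-c(i))$ to elements of $\operatorname{Av}(B)$, and SIE-reducible if it is IE-reducible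 and is not the rightmost entry of $c$ (slots counting as entries). **Theorem.** Let $B$ be a finite set of permutations such that the insertion encoding of $\operatorname{Av}(B)$ is a regular language. Then: 1. The insertion encoding of the set of sum indecomposable permutations in $\operatorname{Av}(B)$ is a regular language, and only finitely many letters occur in it. 2. Every sufficiently long valid configuration for $\operatorname{Av}(B)$ has an SIE-reducible entry. 3. Let $M_0$ be the (infinite) deterministic automaton whose states are the valid configurations for $\operatorname{Av}(B)$, except those configurations other than $\diamond$ whose only slot is their last entry, together with a dead state; the transitions are the insertions $\mathbf m_i,\mathbf l_i,\mathbf r_i,\mathbf f_i$ (leading to the dead state if undefined or if the result is not one of these states), the initial state is $\diamond$ (the dead state if $\diamond$ is not valid), and the accept states are the slotless configurations. Let $\sim$ be the equivalence relation on the states generated by $c\sim\operatorname{st}(c-c(i))$ for all SIE-reducible entries $c(i)$ of states $c$. Then $\sim$ has finitely many classes, the transitions of $M_0$ are well defined on the classes, and the quotient automaton, with the class of the initial state as initial state and the classes of accept states as accept states, accepts exactly the insertion encoding of the set of sum indecomposable permutations in $\operatorname{Av}(B)$. -/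

import Mathlib

namespace InsEnc

/-! ## Permutations, containment, sum indecomposability -/

/-- Permutations in one-line notation: rearrangements of `1, 2, …, n`. -/
def IsPerm (w : List ℕ) : Prop :=
  w.Perm (List.range' 1 w.length)

/-- Two sequences are order isomorphic if they have the same length and the same pairwise
comparisons. -/
def OrderIsomorphic (u v : List ℕ) : Prop :=
  u.length = v.length ∧
    ∀ (i j : ℕ) (hi : i < u.length) (hj : j < u.length) (hi2 : i < v.length) (hj2 : j < v.length),
      u[i] < u[j] ↔ v[i] < v[j]

/-- `w` contains `b`: some subsequence of `w` is order isomorphic to `b`. -/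
def Contains (w b : List ℕ) : Prop :=
  ∃ s : List ℕ, s.Sublist w ∧ OrderIsomorphic s b

/-- `Av(B)`: the permutations that avoid every element of `B`. -/
def Av (B : Set (List ℕ)) : Set (List ℕ) :=
  {w | IsPerm w ∧ ∀ b ∈ B, ¬ Contains w b}

/-- A permutation of length `n` is sum indecomposable if for no `1 ≤ i ≤ n - 1` its first `i`
entries are exactly the values `1, …, i`. -/
def SumIndecomposable (w : List ℕ) : Prop :=
  ¬ ∃ i : ℕ, 1 ≤ i ∧ i < w.length ∧ (w.take i).Perm (List.range' 1 i)

/-! ## Configurations -/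

/-- The underlying type of configurations: `none` is a slot, `some a` is the number `a`. -/
abbrev Word := List (Option ℕ)

/-- A configuration: its numbers form a permutation and no two slots are adjacent. -/
def IsConfig (c : Word) : Prop :=
  IsPerm c.reduceOption ∧ c.IsChain (fun a b => ¬ (a = none ∧ b = none))

/-- The slotless configuration given by a permutation. -/
def ofPerm (w : List ℕ) : Word := w.map some

/-- The letters of the insertion encoding; the slots are numbered `1, 2, …` from left to right. -/
inductive Letter : Type
  /-- insert the new maximum in the middle of slot `i` -/
  | mid (i : ℕ)
  /-- insert the new maximum to the left of slot `i` -/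
  | left (i : ℕ)
  /-- insert the new maximum to the right of slot `i` -/
  | right (i : ℕ)
  /-- fill slot `i` with the new maximum -/
  | fill (i : ℕ)

/-- Replace the `i`th slot by the word `u`; undefined if there is no `i`th slot. -/
def replaceSlot (u : Word) : Word → ℕ → Option Word
  | [], _ => none
  | some a :: c, i => (replaceSlot u c i).map (some a :: ·)
  | none :: _, 0 => none
  | none :: c, 1 => some (u ++ c)
  | none :: c, i + 2 => (replaceSlot u c (i + 1)).map (none :: ·)

/-- The effect of one letter on a configuration (a partial map). -/
def step (c : Word) (a : Letter) : Option Word :=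
  let m : Option ℕ := some (c.reduceOption.length + 1)
  match a with
  | .mid i => replaceSlot [none, m, none] c i
  | .left i => replaceSlot [m, none] c i
  | .right i => replaceSlot [none, m] c i
  | .fill i => replaceSlot [m] c i

/-- The effect of a word of letters on a configuration (a partial map). -/
def run : Word → List Letter → Option Word
  | c, [] => some c
  | c, a :: w => (step c a).bind fun d => run d w

/-- The initial configuration, a single slot. -/
def initial : Word := [none]

/-- The insertion encoding of a set of permutations: all words which lead from the initial
configuration to an element of that set. -/
def insertionEncoding (C : Set (List ℕ)) : Language Letter :=
  {w | ∃ p ∈ C, run initial w = some (ofPerm p)}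

/-- Starting from `c`, the word `w` leads to an accept state, that is, to an element of `Av(B)`. -/
def AcceptsFrom (B : Set (List ℕ)) (c : Word) (w : List Letter) : Prop :=
  ∃ p ∈ Av B, run c w = some (ofPerm p)

/-- A configuration is valid for `Av(B)` if it can be filled to produce an element of `Av(B)`. -/
def Valid (B : Set (List ℕ)) (c : Word) : Prop :=
  ∃ w : List Letter, AcceptsFrom B c w

/-- Indistinguishable states of the (infinite) automaton of configurations. -/
def Indistinguishable (B : Set (List ℕ)) (c d : Word) : Prop :=
  ∀ w : List Letter, AcceptsFrom B c w ↔ AcceptsFrom B d w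

/-! ## Reducible entries -/

/-- Standardization: each number becomes its rank among the numbers, slots are kept. -/
def st (c : Word) : Word :=
  c.map (Option.map fun x => c.reduceOption.countP (fun y => y ≤ x))

/-- Merge adjacent slots into one slot. -/
def mergeSlots : Word → Word
  | [] => []
  | none :: none :: c => mergeSlots (none :: c)
  | x :: c => x :: mergeSlots c

/-- `st(c - c(i))`, with positions counted from `0`.  If `c(i)` has slots on both sides, these
become one slot. -/
def delete (c : Word) (i : ℕ) : Word :=
  st (mergeSlots (c.eraseIdx i))

/-- The entry of `c` in position `i` (counted from `0`) is IE-reducible. -/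
def IEReducible (B : Set (List ℕ)) (c : Word) (i : ℕ) : Prop :=
  i < c.length ∧ Indistinguishable B c (delete c i)

/-- The entry of `c` in position `i` (counted from `0`) is SIE-reducible: it is IE-reducible and is
not the rightmost entry of `c`.  Slots are entries of a configuration too. -/
def SIEReducible (B : Set (List ℕ)) (c : Word) (i : ℕ) : Prop :=
  IEReducible B c i ∧ i + 1 ≠ c.length

/-! ## The automaton for the sum indecomposable permutations -/

/-- The configuration has exactly one slot, and this slot is its last entry. -/
def OnlySlotAtEnd (c : Word) : Prop :=
  c.count none = 1 ∧ c.getLast? = some none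

/-- The configurations that remain: the valid configurations for `Av(B)` without the non-initial
ones whose only slot is at the end. -/
def IsKept (B : Set (List ℕ)) (c : Word) : Prop :=
  IsConfig c ∧ Valid B c ∧ ¬ (c ≠ initial ∧ OnlySlotAtEnd c)

/-- The type of remaining configurations. -/
abbrev Kept (B : Set (List ℕ)) : Type := {c : Word // IsKept B c}

open Classical in
/-- The state of a word: the word itself if it is a remaining configuration, and otherwise the
dead state `none`. -/
noncomputable def toState (B : Set (List ℕ)) (c : Word) : Option (Kept B) :=
  if h : IsKept B c then some ⟨c, h⟩ else none

/-- The infinite automaton on the remaining configurations together with a dead state. -/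
noncomputable def keptAutomaton (B : Set (List ℕ)) : DFA Letter (Option (Kept B)) where
  step s a := s.bind fun c => (step c.1 a).bind fun d => toState B d
  start := toState B initial
  accept := {s | ∃ c : Kept B, s = some c ∧ none ∉ c.1}

/-- The elementary identifications: `c` with `st(c - c(i))` for `c(i)` SIE-reducible. -/
def Identified (B : Set (List ℕ)) (s t : Option (Kept B)) : Prop :=
  ∃ c d : Kept B, s = some c ∧ t = some d ∧ ∃ i : ℕ, SIEReducible B c.1 i ∧ d.1 = delete c.1 i

/-- The states after all these identifications have been made. -/
def SIEState (B : Set (List ℕ)) : Type :=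
  Quotient (Relation.EqvGen.setoid (Identified B))

/-- The class of a state. -/
def SIEState.mk {B : Set (List ℕ)} (s : Option (Kept B)) : SIEState B :=
  Quotient.mk (Relation.EqvGen.setoid (Identified B)) s

end InsEnc

/-! Three facts carry the proof.

Deletion commutes with insertion. Dropping some numbers from a word and standardizing changes
neither its slots nor their numbering, so a word of letters runs on the smaller word exactly when it
runs on the larger one, and the result is the same restriction of the larger result
(`exists_run_st_keep`). Hence acceptance survives deletion. It can be reversed if every set of at
most `L` numbers, `L` bounding the lengths in `B`, can be replaced by a set of retained numbers with
the same restricted configuration (`indistinguishable_st_keep`). With at most `K` slots only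
finitely many restricted configurations arise. One representing set for each uses boundedly many
numbers, so a long configuration has a number outside all of them which is not last and whose
deletion merges no slots (`exists_sieReducible_of_count_le`).

Regularity bounds the slots. The shortest word accepted from a valid configuration has length equal
to its number of slots (`exists_acceptsFrom_length_eq`), so this number depends only on the accepted
language. Configurations reached in the same state of a finite automaton therefore have equally many
slots (`exists_count_none_le`).

Sum indecomposability is visible along the run. A permutation decomposes exactly when its run passes
through a nonempty block of numbers followed by one final slot (`sumIndecomposable_iff`), so
discarding these configurations leaves the desired language. Deleting an SIE-reducible entry
preserves validity, the number of slots and the last entry up to relabelling, hence whether a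
configuration is discarded. Reducibility also persists under transitions
(`SIEReducible.step_delete`). The identifications thus form a congruence compatible with acceptance,
and shrinking long configurations leaves finitely many classes. -/

namespace InsEnc

/-! ## Relabelling the numbers of a configuration -/

/-- Apply a partial function to the numbers of a word, dropping the numbers on which it is
undefined and keeping the slots. -/
def relabel (h : ℕ → Option ℕ) (c : Word) : Word :=
  c.filterMap fun x => x.elim (some none) fun v => (h v).map some

@[simp] theorem relabel_nil (h : ℕ → Option ℕ) : relabel h [] = [] := rfl

@[simp] theorem relabel_none_cons (h : ℕ → Option ℕ) (c : Word) :
    relabel h (none :: c) = none :: relabel h c := rfl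

@[simp] theorem relabel_append (h : ℕ → Option ℕ) (c d : Word) :
    relabel h (c ++ d) = relabel h c ++ relabel h d := List.filterMap_append

theorem relabel_some_cons (h : ℕ → Option ℕ) (v : ℕ) (c : Word) :
    relabel h (some v :: c) = (h v).toList.map some ++ relabel h c := by
  unfold relabel
  cases hv : h v <;> simp [hv]

@[simp] theorem count_none_relabel (h : ℕ → Option ℕ) (c : Word) :
    (relabel h c).count none = c.count none := by
  induction c with
  | nil => rfl
  | cons x c ih =>
    cases x with
    | none => simp [ih]
    | some v => rw [relabel_some_cons]; cases h v <;> simp [ih]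

@[simp] theorem reduceOption_relabel (h : ℕ → Option ℕ) (c : Word) :
    (relabel h c).reduceOption = c.reduceOption.filterMap h := by
  induction c with
  | nil => rfl
  | cons x c ih =>
    cases x with
    | none => simp [List.reduceOption_cons_of_none, ih]
    | some v =>
      rw [relabel_some_cons, List.reduceOption_append, ih, List.reduceOption_cons_of_some,
        List.filterMap_cons]
      cases h v <;> rfl

theorem relabel_relabel (g h : ℕ → Option ℕ) (c : Word) :
    relabel g (relabel h c) = relabel (fun v => (h v).bind g) c := by
  induction c with
  | nil => rfl
  | cons x c ih =>
    cases x with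
    | none => simp [ih]
    | some v =>
      rw [relabel_some_cons, relabel_append, ih, relabel_some_cons]
      cases h v with
      | none => simp
      | some u => simp [relabel_some_cons]

theorem relabel_congr {g h : ℕ → Option ℕ} {c : Word}
    (H : ∀ v ∈ c.reduceOption, g v = h v) : relabel g c = relabel h c := by
  apply List.filterMap_congr
  rintro (_ | v) hv
  · rfl
  · simp [H v (List.reduceOption_mem_iff.2 hv)]

theorem relabel_eq_map {h : ℕ → Option ℕ} {f : ℕ → ℕ} {c : Word}
    (H : ∀ v ∈ c.reduceOption, h v = some (f v)) : relabel h c = c.map (Option.map f) := by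
  rw [relabel_congr H, relabel, ← List.filterMap_eq_map]
  congr 1
  funext x
  cases x <;> rfl

theorem relabel_some (c : Word) : relabel some c = c :=
  (relabel_eq_map (h := some) (f := id) fun _ _ => rfl).trans (by simp)

theorem length_eq_reduceOption_add_count (c : Word) :
    c.length = c.reduceOption.length + c.count none := by
  induction c with
  | nil => rfl
  | cons x c ih =>
    cases x <;> simp [List.reduceOption_cons_of_none, List.reduceOption_cons_of_some, ih] <;> omega

theorem map_some_reduceOption {c : Word} (h : none ∉ c) : c.reduceOption.map some = c := by
  induction c with
  | nil => rfl
  | cons x c ih =>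
    cases x with
    | none => simp at h
    | some v => simp at h; simp [List.reduceOption_cons_of_some, ih h]

@[simp] theorem reduceOption_ofPerm (p : List ℕ) : (ofPerm p).reduceOption = p := by
  induction p with
  | nil => rfl
  | cons v p ih => simpa [ofPerm, List.reduceOption_cons_of_some] using ih

theorem none_notMem_ofPerm (p : List ℕ) : none ∉ ofPerm p := by simp [ofPerm]

/-! ## The effect of a letter -/

/-- The number of the slot a letter acts on. -/
def Letter.index : Letter → ℕ
  | .mid i => i
  | .left i => i
  | .right i => i
  | .fill i => i

/-- The word by which a letter replaces the slot, if `m` is the new maximum. -/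
def Letter.block (m : ℕ) : Letter → Word
  | .mid _ => [none, some m, none]
  | .left _ => [some m, none]
  | .right _ => [none, some m]
  | .fill _ => [some m]

theorem step_eq_replaceSlot (c : Word) (a : Letter) :
    step c a = replaceSlot (a.block (c.reduceOption.length + 1)) c a.index := by
  cases a <;> rfl

/-- Replaces the recursion by a splitting of the word at the slot, the form in which letters are
analysed from here on. -/
theorem replaceSlot_eq_some_iff {u c d : Word} {i : ℕ} :
    replaceSlot u c i = some d ↔
      ∃ x y, c = x ++ none :: y ∧ x.count none + 1 = i ∧ d = x ++ u ++ y := by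
  induction c generalizing i d with
  | nil => simp [replaceSlot]
  | cons o c ih =>
    constructor
    · intro h
      match o, i with
      | some a, i =>
        simp only [replaceSlot, Option.map_eq_some_iff] at h
        obtain ⟨e, he, rfl⟩ := h
        obtain ⟨x, y, rfl, rfl, rfl⟩ := ih.1 he
        exact ⟨some a :: x, y, by simp⟩
      | none, 0 => simp [replaceSlot] at h
      | none, 1 =>
        simp only [replaceSlot, Option.some.injEq] at h
        exact ⟨[], c, by simp [h]⟩
      | none, i + 2 =>
        simp only [replaceSlot, Option.map_eq_some_iff] at h
        obtain ⟨e, he, rfl⟩ := h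
        obtain ⟨x, y, rfl, hx, rfl⟩ := ih.1 he
        exact ⟨none :: x, y, by simp [hx]⟩
    · rintro ⟨x, y, hc, rfl, rfl⟩
      cases x with
      | nil =>
        obtain ⟨rfl, rfl⟩ := List.cons.inj hc
        simp [replaceSlot]
      | cons o' x =>
        obtain ⟨rfl, hc'⟩ := List.cons.inj hc
        change c = x ++ none :: y at hc'
        subst hc'
        have := (ih (i := x.count none + 1)).2 ⟨x, y, rfl, rfl, rfl⟩
        cases o <;> simp_all [replaceSlot]

theorem step_eq_some_iff {c d : Word} {a : Letter} :
    step c a = some d ↔ ∃ x y, c = x ++ none :: y ∧ x.count none + 1 = a.index ∧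
      d = x ++ a.block (c.reduceOption.length + 1) ++ y := by
  rw [step_eq_replaceSlot, replaceSlot_eq_some_iff]

theorem replaceSlot_relabel (h : ℕ → Option ℕ) (u c : Word) (i : ℕ) :
    (replaceSlot u c i).map (relabel h) = replaceSlot (relabel h u) (relabel h c) i := by
  induction c generalizing i with
  | nil => rfl
  | cons o c ih =>
    match o, i with
    | some a, i =>
      rw [relabel_some_cons]
      have := ih i
      cases ha : h a <;>
        simp [replaceSlot, ← this, Function.comp_def, relabel_some_cons, ha]
    | none, 0 => rfl
    | none, 1 => simp [replaceSlot]
    | none, i + 2 =>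
      simp [replaceSlot, ← ih, Function.comp_def]

@[simp] theorem reduceOption_block (m : ℕ) (a : Letter) : (a.block m).reduceOption = [m] := by
  cases a <;> rfl

theorem relabel_block {h : ℕ → Option ℕ} {m m' : ℕ} (hm : h m = some m') (a : Letter) :
    relabel h (a.block m) = a.block m' := by
  cases a <;> simp [Letter.block, relabel_some_cons, hm]

/-- Relabelling never touches slots, so the only condition is that the next maximum of the word goes
to the next maximum of its relabelling. -/
theorem step_relabel {h : ℕ → Option ℕ} {c : Word}
    (hm : h (c.reduceOption.length + 1) = some ((relabel h c).reduceOption.length + 1))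
    (a : Letter) : (step c a).map (relabel h) = step (relabel h c) a := by
  rw [step_eq_replaceSlot, step_eq_replaceSlot, replaceSlot_relabel, relabel_block hm]

theorem reduceOption_perm_of_step {c d : Word} {a : Letter} (h : step c a = some d) :
    d.reduceOption.Perm (c.reduceOption ++ [c.reduceOption.length + 1]) := by
  obtain ⟨x, y, hc, -, rfl⟩ := step_eq_some_iff.1 h
  generalize c.reduceOption.length + 1 = m
  rw [hc]
  simp only [List.reduceOption_append, reduceOption_block, List.reduceOption_cons_of_none,
    List.append_assoc]
  exact (List.perm_append_comm (l₁ := [m])).append_left _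

theorem length_of_step {c d : Word} {a : Letter} (h : step c a = some d) :
    d.reduceOption.length = c.reduceOption.length + 1 := by
  simpa using (reduceOption_perm_of_step h).length_eq

theorem isPerm_of_step {c d : Word} {a : Letter} (hc : IsPerm c.reduceOption)
    (h : step c a = some d) : IsPerm d.reduceOption := by
  unfold IsPerm at *
  rw [length_of_step h, List.range'_concat]
  refine (reduceOption_perm_of_step h).trans ?_
  simpa [Nat.add_comm] using hc.append_right _

theorem isConfig_of_step {c d : Word} {a : Letter} (hc : IsConfig c)
    (h : step c a = some d) : IsConfig d := by
  refine ⟨isPerm_of_step hc.1 h, ?_⟩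
  obtain ⟨x, y, rfl, -, rfl⟩ := step_eq_some_iff.1 h
  have h2 := hc.2
  rw [List.isChain_append, List.isChain_cons] at h2
  obtain ⟨hx, ⟨h0, hy⟩, h1⟩ := h2
  rw [List.append_assoc, List.isChain_append, List.isChain_append]
  refine ⟨hx, ⟨?_, hy, ?_⟩, ?_⟩
  · cases a <;> simp [Letter.block]
  · cases a <;> simp_all [Letter.block]
  · cases a <;> simp_all [Letter.block]

theorem run_append (c : Word) (u v : List Letter) :
    run c (u ++ v) = (run c u).bind fun d => run d v := by
  induction u generalizing c with
  | nil => rfl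
  | cons a u ih => cases h : step c a <;> simp [run, h, ih]

theorem run_relabel {h : ℕ → Option ℕ} {c : Word}
    (hm : ∀ j, h (c.reduceOption.length + j + 1) = some ((relabel h c).reduceOption.length + j + 1))
    (w : List Letter) : (run c w).map (relabel h) = run (relabel h c) w := by
  induction w generalizing c with
  | nil => rfl
  | cons a w ih =>
    have hs := step_relabel (hm 0) a
    rw [run, run, ← hs]
    cases hd : step c a with
    | none => rfl
    | some d =>
      rw [hd] at hs
      simp only [Option.map_some, Option.bind_some]
      apply ih
      intro j
      rw [length_of_step hd, length_of_step hs.symm]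
      simpa [Nat.add_assoc, Nat.add_comm, Nat.add_left_comm] using hm (j + 1)

theorem isPerm_of_run {c d : Word} {w : List Letter} (hc : IsPerm c.reduceOption)
    (h : run c w = some d) : IsPerm d.reduceOption := by
  induction w generalizing c with
  | nil => cases h; exact hc
  | cons a w ih =>
    obtain ⟨e, he, h⟩ := Option.bind_eq_some_iff.1 h
    exact ih (isPerm_of_step hc he) h

theorem isConfig_of_run {c d : Word} {w : List Letter} (hc : IsConfig c)
    (h : run c w = some d) : IsConfig d := by
  induction w generalizing c with
  | nil => cases h; exact hc
  | cons a w ih =>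
    obtain ⟨e, he, h⟩ := Option.bind_eq_some_iff.1 h
    exact ih (isConfig_of_step hc he) h

theorem length_of_run {c d : Word} {w : List Letter} (h : run c w = some d) :
    d.reduceOption.length = c.reduceOption.length + w.length := by
  induction w generalizing c with
  | nil => cases h; rfl
  | cons a w ih =>
    obtain ⟨e, he, h⟩ := Option.bind_eq_some_iff.1 h
    rw [ih h, length_of_step he, List.length_cons]; omega

theorem isPerm_iff {w : List ℕ} : IsPerm w ↔ w.Nodup ∧ ∀ u ∈ w, 1 ≤ u ∧ u ≤ w.length := by
  constructor
  · intro h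
    refine ⟨h.nodup_iff.2 List.nodup_range', fun u hu => ?_⟩
    have := (h.mem_iff (a := u)).1 hu
    simp at this; omega
  · rintro ⟨h1, h2⟩
    refine (h1.subperm fun u hu => ?_).perm_of_length_le (by simp)
    have := h2 u hu
    simp; omega

theorem isConfig_initial : IsConfig initial := ⟨List.Perm.refl _, by simp [initial]⟩

/-! ## Standardization and containment -/

/-- A partial function that is strictly increasing on the entries of a list. -/
def StrictMonoOnList (g : ℕ → Option ℕ) (l : List ℕ) : Prop :=
  ∀ u ∈ l, ∀ v ∈ l, ∀ r s, g u = some r → g v = some s → u < v → r < s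

theorem StrictMonoOnList.lt_iff {g : ℕ → Option ℕ} {l : List ℕ} (hg : StrictMonoOnList g l)
    {u v r s : ℕ} (hu : u ∈ l) (hv : v ∈ l) (hr : g u = some r) (hs : g v = some s) :
    r < s ↔ u < v := by
  refine ⟨fun h => ?_, hg u hu v hv r s hr hs⟩
  rcases lt_trichotomy u v with h1 | rfl | h1
  · exact h1
  · rw [hr] at hs; cases hs; omega
  · have := hg v hv u hu s r hs hr h1; omega

theorem filterMap_eq_map_getD {g : ℕ → Option ℕ} {s : List ℕ} (h : ∀ u ∈ s, (g u).isSome) :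
    s.filterMap g = s.map fun u => (g u).getD 0 := by
  rw [← List.filterMap_eq_map]
  refine List.filterMap_congr fun u hu => ?_
  obtain ⟨r, hr⟩ := Option.isSome_iff_exists.1 (h u hu)
  simp [hr]

theorem orderIsomorphic_map_iff {f : ℕ → ℕ} {s b : List ℕ}
    (hf : ∀ u ∈ s, ∀ v ∈ s, f u < f v ↔ u < v) :
    OrderIsomorphic (s.map f) b ↔ OrderIsomorphic s b := by
  unfold OrderIsomorphic
  simp only [List.length_map, List.getElem_map]
  refine and_congr_right fun hl => forall_congr' fun i => forall_congr' fun j =>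
    forall_congr' fun hi => forall_congr' fun hj => forall_congr' fun _ => forall_congr' fun _ => ?_
  rw [hf _ (List.getElem_mem _) _ (List.getElem_mem _)]

/-- Patterns depend only on comparisons, so an increasing relabelling retains precisely the
occurrences lying inside its domain. -/
theorem contains_filterMap_iff {g : ℕ → Option ℕ} {l b : List ℕ} (hg : StrictMonoOnList g l) :
    Contains (l.filterMap g) b ↔
      ∃ s : List ℕ, s.Sublist l ∧ (∀ u ∈ s, (g u).isSome) ∧ OrderIsomorphic s b := by
  have key : ∀ s : List ℕ, s.Sublist l → (∀ u ∈ s, (g u).isSome) →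
      (OrderIsomorphic (s.filterMap g) b ↔ OrderIsomorphic s b) := by
    intro s hs h
    rw [filterMap_eq_map_getD h]
    refine orderIsomorphic_map_iff fun u hu v hv => ?_
    obtain ⟨r, hr⟩ := Option.isSome_iff_exists.1 (h u hu)
    obtain ⟨t, ht⟩ := Option.isSome_iff_exists.1 (h v hv)
    simpa [hr, ht] using hg.lt_iff (hs.subset hu) (hs.subset hv) hr ht
  constructor
  · rintro ⟨t, ht, hb⟩
    obtain ⟨s, hs, rfl⟩ := List.sublist_filterMap_iff.1 ht
    have h1 : (s.filter fun u => (g u).isSome).Sublist l := List.filter_sublist.trans hs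
    refine ⟨s.filter fun u => (g u).isSome, h1, by simp, ?_⟩
    rw [← key _ h1 (by simp), List.filterMap_filter]
    convert hb using 2 with u
    cases g u <;> rfl
  · rintro ⟨s, hs, h, hb⟩
    exact ⟨s.filterMap g, hs.filterMap g, (key s hs h).2 hb⟩

/-- The rank of `u` in a list of numbers. -/
def rank (l : List ℕ) (u : ℕ) : ℕ := l.countP fun v => v ≤ u

theorem rank_lt_rank {l : List ℕ} {u v : ℕ} (huv : u < v) (hv : v ∈ l) : rank l u < rank l v := by
  induction l with
  | nil => simp at hv
  | cons a l ih =>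
    have hle : rank l u ≤ rank l v := List.countP_mono_left fun x _ h => by
      simp only [decide_eq_true_eq] at *; omega
    unfold rank at *
    rw [List.countP_cons, List.countP_cons]
    rcases List.mem_cons.1 hv with rfl | hv
    · simp [show ¬ v ≤ u by omega]; omega
    · have := ih hv
      by_cases h1 : a ≤ u
      · have h2 : a ≤ v := by omega
        simp [h1, h2]; omega
      · simp [h1]; omega

theorem rank_le_length (l : List ℕ) (u : ℕ) : rank l u ≤ l.length := List.countP_le_length

theorem st_eq_map (c : Word) : st c = c.map (Option.map (rank c.reduceOption)) := rfl

theorem st_eq_relabel (c : Word) : st c = relabel (fun u => some (rank c.reduceOption u)) c := by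
  rw [relabel_eq_map fun _ _ => rfl, st_eq_map]

@[simp] theorem reduceOption_st (c : Word) :
    (st c).reduceOption = c.reduceOption.map (rank c.reduceOption) := by
  rw [st_eq_relabel, reduceOption_relabel, ← List.filterMap_eq_map]
  rfl

@[simp] theorem count_none_st (c : Word) : (st c).count none = c.count none := by
  rw [st_eq_relabel, count_none_relabel]

@[simp] theorem length_st (c : Word) : (st c).length = c.length := by simp [st_eq_map]

theorem rank_range' {n u : ℕ} (h : u ≤ n) : rank (List.range' 1 n) u = u := by
  induction n with
  | zero => obtain rfl : u = 0 := by omega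
            rfl
  | succ n ih =>
    rw [rank, List.range'_concat, List.countP_append]
    by_cases hu : u ≤ n
    · have := ih hu
      rw [rank] at this
      rw [this]
      simp; omega
    · obtain rfl : u = n + 1 := by omega
      rw [List.countP_eq_length.2 (by simp; omega)]
      simp; omega

theorem rank_of_isPerm {l : List ℕ} (h : IsPerm l) {u : ℕ} (hu : u ≤ l.length) : rank l u = u :=
  (h.countP_eq _).trans (rank_range' hu)

theorem st_of_isPerm {c : Word} (h : IsPerm c.reduceOption) : st c = c := by
  rw [st_eq_relabel, relabel_congr (h := some), relabel_some]
  intro v hv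
  rw [rank_of_isPerm h ((isPerm_iff.1 h).2 v hv).2]

theorem isPerm_reduceOption_st {c : Word} (h : c.reduceOption.Nodup) :
    IsPerm (st c).reduceOption := by
  rw [isPerm_iff, reduceOption_st]
  constructor
  · refine h.map_on fun u hu v hv huv => ?_
    rcases lt_trichotomy u v with h1 | h1 | h1
    · have := rank_lt_rank h1 hv; omega
    · exact h1
    · have := rank_lt_rank h1 hu; omega
  · simp only [List.mem_map, List.length_map]
    rintro _ ⟨u, hu, rfl⟩
    refine ⟨?_, rank_le_length _ _⟩
    exact List.countP_pos_iff.2 ⟨u, hu, by simp⟩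

/-- Keep only the numbers with the property `P`. -/
def keep (P : ℕ → Bool) (c : Word) : Word := relabel (fun u => if P u then some u else none) c

@[simp] theorem reduceOption_keep (P : ℕ → Bool) (c : Word) :
    (keep P c).reduceOption = c.reduceOption.filter P := by
  rw [keep, reduceOption_relabel, ← List.filterMap_eq_filter]
  rfl

@[simp] theorem count_none_keep (P : ℕ → Bool) (c : Word) : (keep P c).count none = c.count none :=
  count_none_relabel _ _

theorem keep_congr {P Q : ℕ → Bool} {c : Word} (h : ∀ v ∈ c.reduceOption, P v = Q v) :
    keep P c = keep Q c := relabel_congr fun v hv => by rw [h v hv]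

theorem keep_eq_self {P : ℕ → Bool} {c : Word} (h : ∀ v ∈ c.reduceOption, P v = true) :
    keep P c = c := (relabel_congr fun v hv => by rw [h v hv]; rfl).trans (relabel_some c)

/-- Ranks ignore the values of an increasing relabelling; only its domain matters. -/
theorem st_relabel {g : ℕ → Option ℕ} {c : Word} (hg : StrictMonoOnList g c.reduceOption) :
    st (relabel g c) = st (keep (fun u => (g u).isSome) c) := by
  rw [st_eq_relabel, st_eq_relabel, keep, relabel_relabel, relabel_relabel]
  refine relabel_congr fun v hv => ?_
  cases h : g v with
  | none => simp
  | some r =>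
    simp only [Option.isSome_some, if_true, Option.bind_some, Option.some.injEq]
    rw [reduceOption_relabel, reduceOption_relabel, rank, rank, List.countP_filterMap,
      List.countP_filterMap]
    refine List.countP_congr fun u hu => ?_
    cases h' : g u with
    | none => simp
    | some s =>
      have := hg.lt_iff hv hu h h'
      simp only [Option.map_some, Option.isSome_some, if_true]
      simp
      omega

/-! ## Deleting numbers before running a word -/

/-- The relabelling which standardizes `keep P c` and shifts the numbers that are inserted later. -/
def keepRank (P : ℕ → Bool) (c : Word) (u : ℕ) : Option ℕ :=
  if c.reduceOption.length < u then
    some (u - c.reduceOption.length + (c.reduceOption.filter P).length)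
  else if P u then some (rank (c.reduceOption.filter P) u) else none

theorem isSome_keepRank (P : ℕ → Bool) (c : Word) (u : ℕ) :
    (keepRank P c u).isSome = (decide (c.reduceOption.length < u) || P u) := by
  unfold keepRank
  split_ifs with h1 h2 <;> simp_all

theorem relabel_keepRank {P : ℕ → Bool} {c : Word} (hc : IsPerm c.reduceOption) :
    relabel (keepRank P c) c = st (keep P c) := by
  rw [st_eq_relabel, keep, relabel_relabel]
  refine relabel_congr fun v hv => ?_
  have := ((isPerm_iff.1 hc).2 v hv).2
  rw [keepRank, if_neg (by omega)]
  change _ = Option.bind _ fun u => some (rank (keep P c).reduceOption u)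
  rw [reduceOption_keep]
  split_ifs <;> rfl

theorem map_run_keepRank {P : ℕ → Bool} {c : Word} (hc : IsPerm c.reduceOption) (w : List Letter) :
    (run c w).map (relabel (keepRank P c)) = run (st (keep P c)) w := by
  rw [← relabel_keepRank hc]
  apply run_relabel
  intro j
  rw [relabel_keepRank hc, reduceOption_st, List.length_map, reduceOption_keep, keepRank,
    if_pos (by omega)]
  congr 1
  omega

/-- Retained old numbers receive ranks at most their count, and later numbers are shifted to values
above that count. -/
theorem strictMonoOnList_keepRank {P : ℕ → Bool} {c : Word} (hc : IsPerm c.reduceOption)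
    {l : List ℕ} (hl : IsPerm l) : StrictMonoOnList (keepRank P c) l := by
  intro u hu v hv r s hr hs huv
  have hmem : ∀ x ∈ l, ¬ c.reduceOption.length < x → x ∈ c.reduceOption := by
    intro x hx h
    rw [hc.mem_iff, List.mem_range'_1]
    have := (isPerm_iff.1 hl).2 x hx
    omega
  unfold keepRank at hr hs
  split_ifs at hr hs with h1 h2 h3 h4 h5 h6 <;> cases hr <;> cases hs
  · omega
  · omega
  · have := rank_le_length (c.reduceOption.filter P) u
    omega
  · exact rank_lt_rank huv (List.mem_filter.2 ⟨hmem v hv (by omega), by assumption⟩)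

/-- Numbers above `c.reduceOption.length` are those inserted by `w`, and they always survive. Since
`keep` does not merge slots, `st (keep P c)` may have adjacent slots; for this reason only `IsPerm`
is required, not `IsConfig`. -/
theorem exists_run_st_keep {c D : Word} {w : List Letter} (hc : IsPerm c.reduceOption)
    (h : run c w = some D) (P : ℕ → Bool) :
    ∃ E, run (st (keep P c)) w = some E ∧ (none ∈ E ↔ none ∈ D) ∧ IsPerm E.reduceOption ∧
      E = st (keep (fun u => decide (c.reduceOption.length < u) || P u) D) ∧
      ∀ b, Contains E.reduceOption b ↔ ∃ s : List ℕ, s.Sublist D.reduceOption ∧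
        (∀ u ∈ s, c.reduceOption.length < u ∨ P u = true) ∧ OrderIsomorphic s b := by
  have hD := isPerm_of_run hc h
  have hmono := strictMonoOnList_keepRank (P := P) hc hD
  have hE := map_run_keepRank (P := P) hc w
  rw [h, Option.map_some] at hE
  have hperm : IsPerm (relabel (keepRank P c) D).reduceOption := by
    refine isPerm_of_run (isPerm_reduceOption_st ?_) hE.symm
    rw [reduceOption_keep]
    exact (isPerm_iff.1 hc).1.filter _
  refine ⟨_, hE.symm, ?_, hperm, ?_, fun b => ?_⟩
  · rw [← List.count_pos_iff, count_none_relabel, List.count_pos_iff]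
  · rw [← st_of_isPerm hperm, st_relabel hmono]
    simp only [isSome_keepRank]
  · rw [reduceOption_relabel, contains_filterMap_iff hmono]
    simp only [isSome_keepRank, Bool.or_eq_true, decide_eq_true_eq]

theorem exists_run_of_run_st_keep {c E : Word} {w : List Letter} {P : ℕ → Bool}
    (hc : IsPerm c.reduceOption) (h : run (st (keep P c)) w = some E) :
    ∃ D, run c w = some D := by
  rw [← map_run_keepRank hc] at h
  obtain ⟨D, hD, -⟩ := Option.map_eq_some_iff.1 h
  exact ⟨D, hD⟩

theorem acceptsFrom_iff {B : Set (List ℕ)} {c : Word} (hc : IsPerm c.reduceOption)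
    {w : List Letter} : AcceptsFrom B c w ↔
      ∃ D, run c w = some D ∧ none ∉ D ∧ ∀ b ∈ B, ¬ Contains D.reduceOption b := by
  constructor
  · rintro ⟨p, hp, h⟩
    exact ⟨_, h, none_notMem_ofPerm p, by simpa using hp.2⟩
  · rintro ⟨D, h, h0, hD⟩
    exact ⟨D.reduceOption, ⟨isPerm_of_run hc h, hD⟩, by rw [h, ofPerm, map_some_reduceOption h0]⟩

theorem isPerm_st_keep {c : Word} (hc : IsPerm c.reduceOption) (P : ℕ → Bool) :
    IsPerm (st (keep P c)).reduceOption := by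
  apply isPerm_reduceOption_st
  rw [reduceOption_keep]
  exact (isPerm_iff.1 hc).1.filter _

theorem AcceptsFrom.st_keep {B : Set (List ℕ)} {c : Word} {w : List Letter}
    (hc : IsPerm c.reduceOption) (h : AcceptsFrom B c w) (P : ℕ → Bool) :
    AcceptsFrom B (st (keep P c)) w := by
  obtain ⟨D, hD, h0, hB⟩ := (acceptsFrom_iff hc).1 h
  obtain ⟨E, hE, hn, -, -, hcon⟩ := exists_run_st_keep hc hD P
  refine (acceptsFrom_iff (isPerm_st_keep hc P)).2 ⟨E, hE, by rwa [hn], fun b hb hE' => ?_⟩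
  obtain ⟨s, hs, -, hi⟩ := (hcon b).1 hE'
  exact hB b hb ⟨s, hs, hi⟩

/-- Numbers that are not needed to represent any of the small patterns in `c` can be deleted. -/
theorem indistinguishable_st_keep {B : Set (List ℕ)} {c : Word} {L : ℕ} {P : ℕ → Bool}
    (hc : IsPerm c.reduceOption) (hL : ∀ b ∈ B, b.length ≤ L)
    (hP : ∀ A : Finset ℕ, A.card ≤ L → ∃ A' : Finset ℕ, (∀ u ∈ A', P u = true) ∧
      st (keep (fun u => decide (u ∈ A')) c) = st (keep (fun u => decide (u ∈ A)) c)) :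
    Indistinguishable B c (st (keep P c)) := by
  refine fun w => ⟨fun h => h.st_keep hc P, fun h => ?_⟩
  obtain ⟨E, hE, h0, hB⟩ := (acceptsFrom_iff (isPerm_st_keep hc P)).1 h
  obtain ⟨D, hD⟩ := exists_run_of_run_st_keep hc hE
  obtain ⟨E', hE', hn, -, -, hcon⟩ := exists_run_st_keep hc hD P
  obtain rfl : E = E' := by simpa [hE] using hE'
  refine (acceptsFrom_iff hc).2 ⟨D, hD, by rwa [← hn], fun b hb hDb => hB b hb ?_⟩
  obtain ⟨s, hs, hsb⟩ := hDb
  -- Restricting `c` to the numbers of the occurrence `s` or to `A'` gives the same starting word,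
  -- so `w` leads to the same result. The pattern `b` therefore also occurs in `D` among the numbers
  -- in `A'` and the new ones, all of which survive in `E`.
  obtain ⟨A', hA', hst⟩ := hP s.toFinset
    ((List.toFinset_card_le s).trans (hsb.1.le.trans (hL b hb)))
  obtain ⟨E1, hE1, -, -, -, hcon1⟩ := exists_run_st_keep hc hD fun u => decide (u ∈ s.toFinset)
  obtain ⟨E2, hE2, -, -, -, hcon2⟩ := exists_run_st_keep hc hD fun u => decide (u ∈ A')
  rw [hst, hE1, Option.some.injEq] at hE2
  subst hE2
  obtain ⟨t, ht, htP, htb⟩ := (hcon2 b).1 ((hcon1 b).2 ⟨s, hs, fun u hu => .inr (by simpa), hsb⟩)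
  exact (hcon b).2 ⟨t, ht, fun u hu => (htP u hu).imp_right fun h => hA' u (by simpa using h), htb⟩

/-! ## Deleting an entry -/

theorem mergeSlots_some_cons (v : ℕ) (c : Word) :
    mergeSlots (some v :: c) = some v :: mergeSlots c := by
  rw [mergeSlots]; simp

theorem mergeSlots_none_some_cons (v : ℕ) (c : Word) :
    mergeSlots (none :: some v :: c) = none :: some v :: mergeSlots c := by
  rw [mergeSlots, mergeSlots_some_cons]; simp

/-- No two slots are adjacent. -/
abbrev NoAdjacentSlots (c : Word) : Prop := c.IsChain fun a b => ¬ (a = none ∧ b = none)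

/-- Proved jointly because adjacency at the front is controlled by the unchanged head. -/
theorem mergeSlots_spec (c : Word) : NoAdjacentSlots (mergeSlots c) ∧
    (mergeSlots c).head? = c.head? ∧ (mergeSlots c).reduceOption = c.reduceOption ∧
    (mergeSlots c).Sublist c := by
  induction c with
  | nil => simp [mergeSlots]
  | cons x c ih =>
    obtain ⟨h1, h2, h3, h4⟩ := ih
    match x, c with
    | some v, c =>
      rw [mergeSlots_some_cons]
      refine ⟨List.isChain_cons.2 ⟨by simp, h1⟩, rfl, ?_, h4.cons_cons _⟩
      rw [List.reduceOption_cons_of_some, List.reduceOption_cons_of_some, h3]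
    | none, [] => simp [mergeSlots]
    | none, none :: c =>
      rw [mergeSlots]
      refine ⟨h1, h2, ?_, h4.cons _⟩
      rw [List.reduceOption_cons_of_none, h3]
    | none, some v :: c =>
      rw [mergeSlots_none_some_cons, ← mergeSlots_some_cons]
      refine ⟨List.isChain_cons.2 ⟨by rw [h2]; simp, h1⟩, rfl, ?_, h4.cons_cons _⟩
      rw [List.reduceOption_cons_of_none, List.reduceOption_cons_of_none, h3]

theorem noAdjacentSlots_mergeSlots (c : Word) : NoAdjacentSlots (mergeSlots c) :=
  (mergeSlots_spec c).1

@[simp] theorem reduceOption_mergeSlots (c : Word) :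
    (mergeSlots c).reduceOption = c.reduceOption := (mergeSlots_spec c).2.2.1

theorem count_none_mergeSlots_le (c : Word) : (mergeSlots c).count none ≤ c.count none :=
  (mergeSlots_spec c).2.2.2.count_le _

theorem mergeSlots_eq_self_of_count {c : Word} (h : (mergeSlots c).count none = c.count none) :
    mergeSlots c = c := by
  refine (mergeSlots_spec c).2.2.2.eq_of_length ?_
  rw [length_eq_reduceOption_add_count, length_eq_reduceOption_add_count c, h,
    reduceOption_mergeSlots]

theorem mergeSlots_eq_self {c : Word} (h : NoAdjacentSlots c) : mergeSlots c = c := by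
  induction c with
  | nil => rfl
  | cons x c ih =>
    have ih := ih h.tail
    match x, c with
    | some v, c => rw [mergeSlots_some_cons, ih]
    | none, [] => rfl
    | none, none :: c => simp [NoAdjacentSlots] at h
    | none, some v :: c => rw [mergeSlots_none_some_cons, ← mergeSlots_some_cons, ih]

theorem noAdjacentSlots_map (f : ℕ → ℕ) (c : Word) :
    NoAdjacentSlots (c.map (Option.map f)) ↔ NoAdjacentSlots c := by
  simp [NoAdjacentSlots, List.isChain_map]

theorem noAdjacentSlots_st (c : Word) : NoAdjacentSlots (st c) ↔ NoAdjacentSlots c := by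
  rw [st_eq_map, noAdjacentSlots_map]

theorem isConfig_delete {c : Word} (hc : IsPerm c.reduceOption) (i : ℕ) :
    IsConfig (delete c i) := by
  refine ⟨isPerm_reduceOption_st ?_, ?_⟩
  · rw [reduceOption_mergeSlots]
    exact (isPerm_iff.1 hc).1.sublist ((List.eraseIdx_sublist c i).filterMap id)
  · exact (noAdjacentSlots_st _).2 (noAdjacentSlots_mergeSlots _)

theorem keep_ne_eq {x y : Word} {v : ℕ} (h : (x ++ some v :: y).reduceOption.Nodup) :
    keep (fun u => u != v) (x ++ some v :: y) = x ++ y := by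
  have h' : v ∉ x.reduceOption ∧ v ∉ y.reduceOption := by
    rw [List.reduceOption_append, List.reduceOption_cons_of_some, List.nodup_middle,
      List.nodup_cons] at h
    simpa using h.1
  have hx : keep (fun u => u != v) x = x := keep_eq_self fun u hu => by
    simp; rintro rfl; exact h'.1 hu
  have hy : keep (fun u => u != v) y = y := keep_eq_self fun u hu => by
    simp; rintro rfl; exact h'.2 hu
  unfold keep at *
  rw [relabel_append, relabel_some_cons, hx, hy]
  simp

theorem delete_eq_st_keep {x y : Word} {v : ℕ} (h : (x ++ some v :: y).reduceOption.Nodup)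
    (hxy : NoAdjacentSlots (x ++ y)) :
    delete (x ++ some v :: y) x.length = st (keep (fun u => u != v) (x ++ some v :: y)) := by
  rw [keep_ne_eq h, delete, List.eraseIdx_append_of_length_le le_rfl]
  simp [mergeSlots_eq_self hxy]

/-! ## The number of slots -/

theorem count_none_le_of_step {c d : Word} {a : Letter} (h : step c a = some d) :
    c.count none ≤ d.count none + 1 := by
  obtain ⟨x, y, rfl, -, rfl⟩ := step_eq_some_iff.1 h
  simp only [List.count_append, List.count_cons_self]
  omega

theorem count_none_le_of_run {c d : Word} {w : List Letter} (h : run c w = some d) :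
    c.count none ≤ d.count none + w.length := by
  induction w generalizing c with
  | nil => cases h; simp
  | cons a w ih =>
    obtain ⟨e, he, h⟩ := Option.bind_eq_some_iff.1 h
    have := ih h
    have := count_none_le_of_step he
    simp only [List.length_cons]; omega

theorem AcceptsFrom.count_le {B : Set (List ℕ)} {c : Word} {w : List Letter}
    (h : AcceptsFrom B c w) : c.count none ≤ w.length := by
  obtain ⟨p, -, h⟩ := h
  have := count_none_le_of_run h
  rwa [List.count_eq_zero_of_not_mem (none_notMem_ofPerm p), zero_add] at this

theorem acceptsFrom_cons {B : Set (List ℕ)} {c : Word} {a : Letter} {w : List Letter} :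
    AcceptsFrom B c (a :: w) ↔ ∃ d, step c a = some d ∧ AcceptsFrom B d w := by
  unfold AcceptsFrom
  simp only [run, Option.bind_eq_some_iff]
  constructor
  · rintro ⟨p, hp, d, hd, h⟩; exact ⟨d, hd, p, hp, h⟩
  · rintro ⟨d, hd, p, hp, h⟩; exact ⟨p, hp, d, hd, h⟩

theorem acceptsFrom_nil {B : Set (List ℕ)} {c : Word} :
    AcceptsFrom B c [] ↔ ∃ p ∈ Av B, c = ofPerm p := by
  simp [AcceptsFrom, run]

/-- Deleting the maximum of a configuration that is not standardized further. -/
theorem AcceptsFrom.remove_max {B : Set (List ℕ)} {x y : Word} {m : ℕ} {w : List Letter}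
    (hp : IsPerm (x ++ some m :: y).reduceOption) (hxy : IsPerm (x ++ y).reduceOption)
    (h : AcceptsFrom B (x ++ some m :: y) w) : AcceptsFrom B (x ++ y) w := by
  have := h.st_keep hp fun u => u != m
  rwa [keep_ne_eq (isPerm_iff.1 hp).1, st_of_isPerm hxy] at this

/-- A word as short as the number of slots must fill one slot with each letter. Omitting the letter
that fills the chosen slot amounts to deleting one entry of the final permutation, which preserves
avoidance. -/
theorem exists_acceptsFrom_remove_slot {B : Set (List ℕ)} {x y : Word} {w : List Letter}
    (hp : IsPerm (x ++ none :: y).reduceOption) (h : AcceptsFrom B (x ++ none :: y) w)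
    (hw : w.length = (x ++ none :: y).count none) :
    ∃ w', w'.length + 1 = w.length ∧ AcceptsFrom B (x ++ y) w' := by
  induction w generalizing x y with
  | nil => simp at hw
  | cons a w ih =>
    obtain ⟨d, hd, hdw⟩ := acceptsFrom_cons.1 h
    have hdp := isPerm_of_step hp hd
    obtain ⟨x', y', hxy, ha, rfl⟩ := step_eq_some_iff.1 hd
    have hcount := hdw.count_le
    have hxy_count := congrArg (List.count none) hxy
    set m := (x ++ none :: y).reduceOption.length + 1 with hm
    simp only [List.length_cons, List.count_append, List.count_cons_self] at *
    -- The remaining word has one letter fewer than `x ++ none :: y` has slots, so this letter must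
    -- destroy a slot.
    have hblock : a.block m = [some m] := by
      cases a <;> simp [Letter.block] at hcount ⊢ <;> omega
    rw [hblock] at hdw hdp hd hcount
    have hp' : IsPerm (x ++ y).reduceOption := by
      simpa [List.reduceOption_append, List.reduceOption_cons_of_none] using hp
    rcases List.append_eq_append_iff.1 hxy with ⟨z, rfl, hz⟩ | ⟨z, rfl, hz⟩
    · cases z with
      | nil =>
        obtain ⟨-, rfl⟩ := List.cons.inj hz
        exact ⟨w, rfl, AcceptsFrom.remove_max (m := m) (by simpa using hdp) hp'
          (by simpa using hdw)⟩
      | cons o z =>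
        obtain ⟨rfl, rfl⟩ := List.cons.inj hz
        obtain ⟨w', hw', hacc⟩ := ih (x := x) (y := z ++ some m :: y') (by simpa using hdp)
          (by simpa using hdw) (by simp at hw ⊢; omega)
        -- The filled slot lies to the right of the removed one, so its number drops by one.
        refine ⟨Letter.fill (x.count none + z.count none + 1) :: w', by simp [hw'],
          acceptsFrom_cons.2 ⟨_, step_eq_some_iff.2 ⟨x ++ z, y', by simp, ?_, rfl⟩, ?_⟩⟩
        · simp [Letter.index]
        · convert hacc using 1
          simp [Letter.block, hm, List.reduceOption_append, List.reduceOption_cons_of_none]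
    · cases z with
      | nil =>
        obtain ⟨-, rfl⟩ := List.cons.inj hz
        exact ⟨w, rfl, AcceptsFrom.remove_max (m := m) (by simpa using hdp)
          (by simpa using hp') (by simpa using hdw)⟩
      | cons o z =>
        obtain ⟨rfl, rfl⟩ := List.cons.inj hz
        obtain ⟨w', hw', hacc⟩ := ih (x := x' ++ some m :: z) (y := y) (by simpa using hdp)
          (by simpa using hdw) (by simp at hw ⊢; omega)
        refine ⟨Letter.fill (x'.count none + 1) :: w', by simp [hw'],
          acceptsFrom_cons.2 ⟨_, step_eq_some_iff.2 ⟨x', z ++ y, by simp, ?_, rfl⟩, ?_⟩⟩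
        · simp [Letter.index]
        · convert hacc using 1
          simp [Letter.block, hm, List.reduceOption_append, List.reduceOption_cons_of_none]

/-- Letters other than fills are superfluous: after a left or right insertion the new maximum can be
deleted, giving `c` again, and after a middle insertion one of the two new slots can be removed as
well. -/
theorem exists_acceptsFrom_length_eq {B : Set (List ℕ)} {c : Word} {w : List Letter}
    (hp : IsPerm c.reduceOption) (h : AcceptsFrom B c w) :
    ∃ w', w'.length = c.count none ∧ AcceptsFrom B c w' := by
  induction w generalizing c with
  | nil =>
    refine ⟨[], ?_, h⟩
    obtain ⟨p, -, rfl⟩ := acceptsFrom_nil.1 h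
    rw [List.count_eq_zero_of_not_mem (none_notMem_ofPerm p), List.length_nil]
  | cons a w ih =>
    obtain ⟨d, hd, hdw⟩ := acceptsFrom_cons.1 h
    have hdp := isPerm_of_step hp hd
    obtain ⟨w', hw', hacc⟩ := ih hdp hdw
    obtain ⟨x, y, hc, ha, rfl⟩ := step_eq_some_iff.1 hd
    generalize hm : c.reduceOption.length + 1 = m at *
    subst hc
    cases a with
    | fill i =>
      exact ⟨.fill i :: w', by simp [hw', Letter.block, Nat.add_assoc],
        acceptsFrom_cons.2 ⟨_, hd, hacc⟩⟩
    | left i =>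
      refine ⟨w', by simp [hw', Letter.block], ?_⟩
      exact AcceptsFrom.remove_max (m := m) (x := x) (y := none :: y)
        (by simpa [Letter.block] using hdp) hp (by simpa [Letter.block] using hacc)
    | right i =>
      refine ⟨w', by simp [hw', Letter.block], ?_⟩
      have := AcceptsFrom.remove_max (B := B) (w := w') (m := m) (x := x ++ [none]) (y := y)
        (by simpa [Letter.block] using hdp) (by simpa using hp)
        (by simpa [Letter.block] using hacc)
      simpa using this
    | mid i =>
      obtain ⟨w'', hw'', hacc'⟩ := exists_acceptsFrom_remove_slot (B := B) (w := w') (x := x)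
        (y := some m :: none :: y) (by simpa [Letter.block] using hdp)
        (by simpa [Letter.block] using hacc) (by simpa [Letter.block] using hw')
      refine ⟨w'', by simp [hw', Letter.block] at hw'' ⊢; omega, ?_⟩
      refine AcceptsFrom.remove_max (m := m) (x := x) (y := none :: y) ?_ hp hacc'
      simpa [Letter.block, List.reduceOption_append, List.reduceOption_cons_of_none,
        List.reduceOption_cons_of_some] using hdp

/-- The number of slots is the minimal length of an accepted word, hence an invariant of the
accepted language. -/
theorem Indistinguishable.count_eq {B : Set (List ℕ)} {c d : Word} (h : Indistinguishable B c d)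
    (hc : IsPerm c.reduceOption) (hd : IsPerm d.reduceOption) (hv : Valid B c) :
    c.count none = d.count none := by
  obtain ⟨w, hw⟩ := hv
  obtain ⟨u, hu, hcu⟩ := exists_acceptsFrom_length_eq hc hw
  obtain ⟨v, hv, hdv⟩ := exists_acceptsFrom_length_eq hd ((h w).1 hw)
  have := ((h u).1 hcu).count_le
  have := ((h v).2 hdv).count_le
  omega

theorem Indistinguishable.of_step {B : Set (List ℕ)} {c d c' d' : Word} {a : Letter}
    (h : Indistinguishable B c d) (hc : step c a = some c') (hd : step d a = some d') :
    Indistinguishable B c' d' := by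
  intro w
  have := h (a :: w)
  simpa [acceptsFrom_cons, hc, hd] using this

/-! ## Reducible entries -/

/-- An IE-reducible entry of a valid configuration is a number that does not separate two slots. -/
theorem IEReducible.exists_eq {B : Set (List ℕ)} {c : Word} {i : ℕ} (h : IEReducible B c i)
    (hc : IsPerm c.reduceOption) (hv : Valid B c) :
    ∃ x v y, c = x ++ some v :: y ∧ x.length = i ∧ NoAdjacentSlots (x ++ y) := by
  obtain ⟨hi, h⟩ := h
  have hcount := h.count_eq hc (isConfig_delete hc i).1 hv
  have hdel : (delete c i).count none = (mergeSlots (c.eraseIdx i)).count none :=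
    count_none_st _
  have hle := count_none_mergeSlots_le (c.eraseIdx i)
  have hsplit : c = c.take i ++ (c)[i] :: c.drop (i + 1) := by simp
  have hcc := congrArg (List.count none) hsplit
  rw [List.eraseIdx_eq_take_drop_succ] at *
  cases hci : (c)[i] with
  | none =>
    rw [hci, List.count_append, List.count_cons_self] at hcc
    rw [List.count_append] at hle
    omega
  | some v =>
    rw [hci, List.count_append, List.count_cons_of_ne (by simp), ← List.count_append] at hcc
    refine ⟨c.take i, v, c.drop (i + 1), by rw [← hci]; exact hsplit, by simp; omega, ?_⟩
    rw [← mergeSlots_eq_self_of_count (by omega : _ = (c.take i ++ c.drop (i + 1)).count none)]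
    exact noAdjacentSlots_mergeSlots _

/-- Each slot excludes at most itself and the number right after it, and each element of `U`
excludes one entry; the remaining `2` accounts for `v` and a nonempty `y`. As no slot precedes `v`,
deleting it makes no slots adjacent. -/
theorem exists_split {c : Word} {U : Finset ℕ} (hc : c.reduceOption.Nodup)
    (h : 2 * c.count none + U.card + 2 ≤ c.length) :
    ∃ x v y, c = x ++ some v :: y ∧ y ≠ [] ∧ v ∉ U ∧ x.getLast? ≠ some none := by
  induction hn : c.length using Nat.strong_induction_on generalizing c U with
  | _ n ih =>
  subst hn
  match c with
  | [] => simp at h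
  | none :: [] => simp at h
  | none :: none :: c =>
    obtain ⟨x, v, y, hxy, hy, hv, hx⟩ := ih (c := none :: c) (U := U) _ (by simp)
      (by simpa [List.reduceOption_cons_of_none] using hc) (by simp at h ⊢; omega) rfl
    cases x with
    | nil => simp at hxy
    | cons o x =>
      refine ⟨none :: o :: x, v, y, by simpa using hxy, hy, hv, by simpa using hx⟩
  | none :: some u :: c =>
    have hc' : c.reduceOption.Nodup := by
      rw [List.reduceOption_cons_of_none, List.reduceOption_cons_of_some] at hc
      exact hc.of_cons
    obtain ⟨x, v, y, rfl, hy, hv, hx⟩ := ih (c := c) (U := U) _ (by simp) hc'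
      (by simp at h ⊢; omega) rfl
    refine ⟨none :: some u :: x, v, y, by simp, hy, hv, ?_⟩
    cases x with
    | nil => simp
    | cons o x => simpa using hx
  | some u :: c =>
    by_cases hu : u ∈ U
    · rw [List.reduceOption_cons_of_some, List.nodup_cons] at hc
      have hU := Finset.card_erase_add_one hu
      obtain ⟨x, v, y, rfl, hy, hv, hx⟩ := ih (c := c) (U := U.erase u) _ (by simp) hc.2
        (by simp at h ⊢; omega) rfl
      refine ⟨some u :: x, v, y, by simp, hy, fun hvU => hv (Finset.mem_erase.2 ⟨?_, hvU⟩), ?_⟩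
      · rintro rfl
        exact hc.1 (List.reduceOption_mem_iff.2 (by simp))
      · cases x with
        | nil => simp
        | cons o x => simpa using hx
    · refine ⟨[], u, c, rfl, ?_, hu, by simp⟩
      rintro rfl
      simp at h

theorem finite_setOf_words (M : ℕ) :
    {c : Word | IsPerm c.reduceOption ∧ c.length ≤ M}.Finite := by
  have h := (List.finite_length_le (Option (Fin (M + 1))) M).image
    (List.map (Option.map fun v : Fin (M + 1) => (v : ℕ)))
  refine h.subset ?_
  rintro c ⟨hc, hM⟩
  refine ⟨c.map (Option.map (Fin.ofNat (M + 1))), by simpa using hM, ?_⟩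
  rw [List.map_map]
  conv_rhs => rw [← List.map_id c]
  refine List.map_congr_left ?_
  rintro (_ | v) hv
  · rfl
  · have h1 := ((isPerm_iff.1 hc).2 v (List.reduceOption_mem_iff.2 hv)).2
    have h2 := List.reduceOption_length_le c
    simp [Nat.mod_eq_of_lt (show v < M + 1 by omega)]

theorem exists_sieReducible_of_count_le {B : Set (List ℕ)} (hB : B.Finite) (K : ℕ) :
    ∃ N : ℕ, ∀ c : Word, IsConfig c → c.count none ≤ K → N ≤ c.length →
      ∃ i : ℕ, SIEReducible B c i := by
  classical
  obtain ⟨L, hL⟩ : ∃ L, ∀ b ∈ B, b.length ≤ L := by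
    obtain ⟨L, hL⟩ := (hB.image List.length).bddAbove
    exact ⟨L, fun b hb => hL ⟨b, hb, rfl⟩⟩
  -- `T` contains every restriction of `c` to at most `L` numbers. One representing set per element
  -- of `T`, each of size at most `L`, gives a union of size at most `T.card * L`.
  let T := (finite_setOf_words (L + K)).toFinset
  refine ⟨2 * K + T.card * L + 2, fun c hc hK hlen => ?_⟩
  have hA : ∀ t : Word, ∃ A : Finset ℕ, A.card ≤ L ∧
      ((∃ A' : Finset ℕ, A'.card ≤ L ∧ st (keep (fun u => decide (u ∈ A')) c) = t) →
        st (keep (fun u => decide (u ∈ A)) c) = t) := by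
    intro t
    by_cases h : ∃ A' : Finset ℕ, A'.card ≤ L ∧ st (keep (fun u => decide (u ∈ A')) c) = t
    · obtain ⟨A, h1, h2⟩ := h
      exact ⟨A, h1, fun _ => h2⟩
    · exact ⟨∅, by simp, fun h' => absurd h' h⟩
  choose A hAcard hA using hA
  have hnodup := (isPerm_iff.1 hc.1).1
  obtain ⟨x, v, y, rfl, hy, hv, hx⟩ := exists_split (U := T.biUnion A) hnodup (by
    have := Finset.card_biUnion_le_card_mul T A L fun t _ => hAcard t
    omega)
  have hchain : NoAdjacentSlots (x ++ y) := by
    have := hc.2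
    rw [List.isChain_append, List.isChain_cons] at this
    refine List.isChain_append.2 ⟨this.1, this.2.1.2, ?_⟩
    rintro a ha b - ⟨rfl, -⟩
    exact hx ha
  refine ⟨x.length, ⟨by simp, ?_⟩, ?_⟩
  · rw [delete_eq_st_keep hnodup hchain]
    refine indistinguishable_st_keep hc.1 hL fun S hS => ?_
    refine ⟨A (st (keep (fun u => decide (u ∈ S)) (x ++ some v :: y))), fun u hu => ?_,
      hA _ ⟨S, hS, rfl⟩⟩
    simp only [bne_iff_ne]
    rintro rfl
    refine hv (Finset.mem_biUnion.2 ⟨_, ?_, hu⟩)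
    refine (Set.Finite.mem_toFinset _).2 ⟨isPerm_st_keep hc.1 _, ?_⟩
    rw [length_st, length_eq_reduceOption_add_count, count_none_keep, reduceOption_keep]
    refine Nat.add_le_add (le_trans ?_ hS) hK
    rw [← List.toFinset_card_of_nodup (hnodup.filter _)]
    exact Finset.card_le_card fun z hz => by
      simpa using (List.mem_filter.1 (List.mem_toFinset.1 hz)).2
  · have := List.length_pos_iff.2 hy
    simp; omega

/-! ## Every nonempty configuration is reachable -/

/-- The last insertion is undone by replacing the maximum together with its neighbouring slots by a
single slot; which neighbours are slots determines the letter. -/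
theorem exists_step_eq {d : Word} (hd : IsConfig d) (h : d.reduceOption ≠ []) :
    ∃ c a, IsConfig c ∧ c ≠ [] ∧ step c a = some d := by
  obtain ⟨n, hn⟩ : ∃ n, d.reduceOption.length = n + 1 :=
    Nat.exists_eq_succ_of_ne_zero (by simpa using h)
  have hmem : some (n + 1) ∈ d := by
    rw [← List.reduceOption_mem_iff, hd.1.mem_iff, List.mem_range'_1]
    omega
  obtain ⟨x, y, rfl⟩ := List.append_of_mem hmem
  obtain ⟨x, X, y, Y, rfl, rfl, hX, hY, hx, hy⟩ : ∃ x' X y' Y, x = x' ++ X ∧ y = Y ++ y' ∧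
      (X = [] ∨ X = [none]) ∧ (Y = [] ∨ Y = [none]) ∧ x'.getLast? ≠ some none ∧
      y'.head? ≠ some none := by
    obtain ⟨x', X, rfl, hX, hx⟩ : ∃ x' X, x = x' ++ X ∧ (X = [] ∨ X = [none]) ∧
        x'.getLast? ≠ some none := by
      by_cases h : x.getLast? = some none
      · obtain ⟨x', rfl⟩ := List.getLast?_eq_some_iff.1 h
        refine ⟨x', [none], rfl, .inr rfl, fun h' => ?_⟩
        have := hd.2
        rw [List.append_assoc, List.isChain_append] at this
        exact this.2.2 none h' none rfl ⟨rfl, rfl⟩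
      · exact ⟨x, [], by simp, .inl rfl, h⟩
    obtain ⟨y', Y, rfl, hY, hy⟩ : ∃ y' Y, y = Y ++ y' ∧ (Y = [] ∨ Y = [none]) ∧
        y'.head? ≠ some none := by
      by_cases h : y.head? = some none
      · obtain ⟨y', rfl⟩ := List.head?_eq_some_iff.1 h
        refine ⟨y', [none], rfl, .inr rfl, fun h' => ?_⟩
        have := hd.2
        rw [List.isChain_append] at this
        exact (List.isChain_cons.1 this.2.1.tail).1 none h' ⟨rfl, rfl⟩
      · exact ⟨y, [], by simp, .inl rfl, h⟩
    exact ⟨x', X, y', Y, rfl, rfl, hX, hY, hx, hy⟩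
  have hX0 : X.reduceOption = [] := by rcases hX with rfl | rfl <;> rfl
  have hY0 : Y.reduceOption = [] := by rcases hY with rfl | rfl <;> rfl
  have hlen : (x ++ none :: y).reduceOption.length = n := by
    simp only [List.reduceOption_append, List.reduceOption_cons_of_some,
      List.reduceOption_cons_of_none, hX0, hY0, List.length_append, List.length_cons,
      List.length_nil] at hn ⊢
    omega
  refine ⟨x ++ none :: y, if X = [] then (if Y = [] then .fill (x.count none + 1) else
    .left (x.count none + 1)) else (if Y = [] then .right (x.count none + 1) else
    .mid (x.count none + 1)), ⟨?_, ?_⟩, by simp, step_eq_some_iff.2 ⟨x, y, rfl, ?_, ?_⟩⟩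
  · have h1 := hd.1
    unfold IsPerm at h1 ⊢
    rw [hlen]
    rw [hn, List.range'_concat] at h1
    simp only [List.reduceOption_append, List.reduceOption_cons_of_some,
      List.reduceOption_cons_of_none, hX0, hY0, List.append_nil, List.nil_append] at h1 ⊢
    have h2 := List.perm_middle.symm.trans (h1.trans (List.perm_append_comm))
    rw [Nat.one_mul, Nat.add_comm 1 n] at h2
    exact h2.cons_inv
  · have := hd.2
    rw [List.append_assoc, List.isChain_append, List.isChain_append, List.isChain_cons,
      List.isChain_append] at this
    rw [List.isChain_append, List.isChain_cons]
    refine ⟨this.1, ⟨?_, this.2.1.2.1.2.2.1⟩, ?_⟩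
    · rintro z hz ⟨-, rfl⟩; exact hy hz
    · rintro z hz _ - ⟨rfl, -⟩; exact hx hz
  · split_ifs <;> rfl
  · rw [hlen]
    rcases hX with rfl | rfl <;> rcases hY with rfl | rfl <;> simp [Letter.block]

theorem exists_run_initial {c : Word} (hc : IsConfig c) (h : c ≠ []) :
    ∃ w, run initial w = some c := by
  induction hn : c.reduceOption.length generalizing c with
  | zero =>
    refine ⟨[], ?_⟩
    rw [run, initial]
    match c with
    | [] => simp at h
    | some v :: c => simp [List.reduceOption_cons_of_some] at hn
    | [none] => rfl
    | none :: none :: c => simpa using hc.2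
    | none :: some v :: c =>
      simp [List.reduceOption_cons_of_some, List.reduceOption_cons_of_none] at hn
  | succ n ih =>
    obtain ⟨e, a, he, he0, hs⟩ := exists_step_eq hc (by rintro h; simp [h] at hn)
    obtain ⟨w, hw⟩ := ih he he0 (by have := length_of_step hs; omega)
    exact ⟨w ++ [a], by simp [run_append, hw, run, hs]⟩

theorem mem_insertionEncoding_append {B : Set (List ℕ)} {c : Word} {u : List Letter}
    (hu : run initial u = some c) (v : List Letter) :
    u ++ v ∈ insertionEncoding (Av B) ↔ AcceptsFrom B c v := by
  change (∃ p ∈ Av B, _) ↔ _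
  simp [run_append, hu, AcceptsFrom]

/-- If the insertion encoding is regular, then the number of slots of valid configurations is
bounded. -/
theorem exists_count_none_le {B : Set (List ℕ)}
    (hreg : (insertionEncoding (Av B)).IsRegular) :
    ∃ K, ∀ c, IsConfig c → Valid B c → c.count none ≤ K := by
  obtain ⟨σ, _, M, hM⟩ := hreg
  -- The slot counts of valid configurations reached by words that `M` reads into `s`. Such
  -- configurations have the same accepted language, so each `S s` has at most one element.
  let S : σ → Set ℕ := fun s => {k | ∃ c u, IsConfig c ∧ Valid B c ∧ run initial u = some c ∧
    M.eval u = s ∧ c.count none = k}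
  have hS : ∀ s, (S s).Subsingleton := by
    rintro s k ⟨c, u, hc, hv, hu, hs, rfl⟩ k' ⟨c', u', hc', hv', hu', hs', rfl⟩
    refine Indistinguishable.count_eq (fun w => ?_) hc.1 hc'.1 hv
    rw [← mem_insertionEncoding_append hu, ← mem_insertionEncoding_append hu', ← hM,
      DFA.mem_accepts, DFA.mem_accepts, DFA.eval, DFA.evalFrom_of_append, ← DFA.eval, hs,
      DFA.eval, DFA.evalFrom_of_append, ← DFA.eval, hs']
  obtain ⟨K, hK⟩ := (Set.finite_iUnion fun s => (hS s).finite).bddAbove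
  refine ⟨K, fun c hc hv => ?_⟩
  -- The empty configuration is not reachable from a single slot, but it has no slots anyway.
  by_cases h : c = []
  · simp [h]
  · obtain ⟨u, hu⟩ := exists_run_initial hc h
    exact hK (Set.mem_iUnion.2 ⟨M.eval u, c, u, hc, hv, hu, rfl, rfl⟩)

theorem finite_letters (K : ℕ) : {a : Letter | a.index ≤ K}.Finite := by
  have h := Set.finite_Iic K
  refine ((((h.image .mid).union (h.image .left)).union (h.image .right)).union
    (h.image .fill)).subset ?_
  rintro (i | i | i | i) hi <;> simpa [Letter.index] using hi

theorem index_le_of_acceptsFrom {B : Set (List ℕ)} {K : ℕ}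
    (hK : ∀ c, IsConfig c → Valid B c → c.count none ≤ K) {c : Word} (hc : IsConfig c)
    {w : List Letter} (h : AcceptsFrom B c w) : ∀ a ∈ w, a.index ≤ K := by
  induction w generalizing c with
  | nil => simp
  | cons a w ih =>
    have hcount := hK c hc ⟨_, h⟩
    obtain ⟨d, hd, hw⟩ := acceptsFrom_cons.1 h
    rintro b hb
    rcases List.mem_cons.1 hb with rfl | hb
    · obtain ⟨x, y, rfl, hx, -⟩ := step_eq_some_iff.1 hd
      rw [List.count_append, List.count_cons_self] at hcount
      omega
    · exact ih (isConfig_of_step hc hd) hw b hb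

/-! ## Sum indecomposability along a run -/

/-- Letters act only at slots, so a slotless prefix is frozen, and a nonempty remainder never
becomes empty. -/
theorem run_map_some_append {q : List ℕ} {r D : Word} {w : List Letter}
    (h : run (q.map some ++ r) w = some D) :
    ∃ r', D = q.map some ++ r' ∧ (r ≠ [] → r' ≠ []) := by
  induction w generalizing r with
  | nil => cases h; exact ⟨r, rfl, id⟩
  | cons a w ih =>
    obtain ⟨e, he, h⟩ := Option.bind_eq_some_iff.1 h
    obtain ⟨x, y, hxy, -, rfl⟩ := step_eq_some_iff.1 he
    generalize (q.map some ++ r).reduceOption.length + 1 = m at *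
    obtain ⟨z, rfl, hz⟩ : ∃ z, x = q.map some ++ z ∧ r = z ++ none :: y := by
      rcases List.append_eq_append_iff.1 hxy with ⟨z, rfl, rfl⟩ | ⟨z, hq, hz⟩
      · exact ⟨z, rfl, rfl⟩
      · cases z with
        | nil => exact ⟨[], by simpa using hq.symm, by simpa using hz.symm⟩
        | cons o z =>
          obtain ⟨rfl, -⟩ := List.cons.inj hz
          have : none ∈ q.map some := by rw [hq]; simp
          simp at this
    obtain ⟨r', rfl, hr'⟩ := ih (r := z ++ a.block m ++ y) (by simpa using h)
    refine ⟨r', rfl, fun _ => hr' ?_⟩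
    cases a <;> simp [Letter.block]

/-- The numbers of `q` are too small to have been inserted by `w`. An insertion before or between
them would leave a slot or a larger number inside the prefix, so they already form a prefix of `c`.
-/
theorem eq_map_some_append_of_run {q : List ℕ} {c r : Word} {w : List Letter}
    (hq : ∀ v ∈ q, v ≤ c.reduceOption.length) (hr : r ≠ [])
    (h : run c w = some (q.map some ++ r)) : ∃ r', r' ≠ [] ∧ c = q.map some ++ r' := by
  induction w generalizing c with
  | nil => cases h; exact ⟨r, hr, rfl⟩
  | cons a w ih =>
    obtain ⟨e, he, h⟩ := Option.bind_eq_some_iff.1 h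
    obtain ⟨r', hr', hre⟩ := ih (fun v hv => by have := hq v hv; rw [length_of_step he]; omega) h
    obtain ⟨x, y, hxy, -, rfl⟩ := step_eq_some_iff.1 he
    generalize hm : c.reduceOption.length + 1 = m at *
    rw [List.append_assoc] at hre
    rcases List.append_eq_append_iff.1 hre with ⟨z, hz, hz'⟩ | ⟨z, rfl, -⟩
    · cases z with
      | nil => exact ⟨none :: y, by simp, by rw [hxy, hz, List.append_nil]⟩
      | cons o z =>
        have hoq : o ∈ q.map some := by rw [hz]; simp
        obtain ⟨v, hv, rfl⟩ := List.mem_map.1 hoq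
        have := hq v hv
        cases a <;> simp [Letter.block] at hz' <;> omega
    · exact ⟨z ++ none :: y, by simp, by rw [hxy, List.append_assoc]⟩

theorem sumIndecomposable_iff {p : List ℕ} {w : List Letter}
    (h : run initial w = some (ofPerm p)) :
    SumIndecomposable p ↔ ∀ u v, w = u ++ v → ∀ c, run initial u = some c →
      ¬ (c ≠ initial ∧ OnlySlotAtEnd c) := by
  rw [SumIndecomposable, ← not_iff_not]
  push Not
  constructor
  · rintro ⟨i, hi1, hi2, hi⟩
    have hlen : p.length = w.length := by
      have := length_of_run h
      simpa [initial, List.reduceOption_cons_of_none] using this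
    have hw : w = w.take i ++ w.drop i := (List.take_append_drop i w).symm
    have h' := h
    rw [hw, run_append, Option.bind_eq_some_iff] at h'
    obtain ⟨c, hc, hcv⟩ := h'
    have hclen := length_of_run hc
    simp only [initial, List.reduceOption_cons_of_none, List.reduceOption_nil, List.length_nil,
      List.length_take, zero_add] at hclen
    refine ⟨w.take i, w.drop i, hw, c, hc, ?_⟩
    have hpi : ofPerm p = (p.take i).map some ++ (p.drop i).map some := by
      rw [← List.map_append, List.take_append_drop, ofPerm]
    rw [hpi] at hcv
    -- After `i` letters exactly `1, …, i` are present, and these are the first `i` entries of `p`.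
    -- What follows them is nonempty and without numbers, hence a single slot.
    obtain ⟨r, hr, rfl⟩ := eq_map_some_append_of_run (fun v hv => by
      have := hi.mem_iff.1 hv
      rw [List.mem_range'_1] at this
      omega) (by simp; omega) hcv
    have hr0 : r.reduceOption = [] := by
      change ((ofPerm (p.take i) ++ r).reduceOption).length = _ at hclen
      rw [List.reduceOption_append, reduceOption_ofPerm, List.length_append,
        List.length_take] at hclen
      exact List.eq_nil_of_length_eq_zero (by omega)
    have hchain := (List.isChain_append.1 (isConfig_of_run isConfig_initial hc).2).2.1
    obtain rfl : r = [none] := by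
      match r with
      | [] => simp at hr
      | some v :: r => simp [List.reduceOption_cons_of_some] at hr0
      | [none] => rfl
      | none :: none :: r => simp at hchain
      | none :: some v :: r =>
        simp [List.reduceOption_cons_of_some, List.reduceOption_cons_of_none] at hr0
    refine ⟨fun h0 => ?_, ?_, by simp⟩
    · have := congrArg List.length h0
      simp only [initial, List.length_append, List.length_map, List.length_take,
        List.length_cons, List.length_nil] at this
      omega
    · rw [List.count_append, show List.count none ((p.take i).map some) = 0 from
        List.count_eq_zero_of_not_mem (none_notMem_ofPerm _)]
      simp
  · rintro ⟨u, v, rfl, c, hc, h0, hcount, hlast⟩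
    have hconf := isConfig_of_run isConfig_initial hc
    obtain ⟨e, rfl⟩ := List.getLast?_eq_some_iff.1 hlast
    have he : none ∉ e := by
      rw [List.count_append] at hcount
      exact List.count_eq_zero.1 (by simpa using hcount)
    rw [run_append, hc, Option.bind_some, ← map_some_reduceOption he] at h
    obtain ⟨r, hr, hr0⟩ := run_map_some_append h
    have hr0 := List.length_pos_iff.2 (hr0 (by simp))
    have hp := congrArg List.reduceOption hr
    rw [reduceOption_ofPerm, List.reduceOption_append] at hp
    change p = (ofPerm _).reduceOption ++ _ at hp
    rw [reduceOption_ofPerm] at hp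
    have hlen := congrArg List.length hr
    simp [ofPerm] at hlen
    refine ⟨e.reduceOption.length, ?_, by omega, ?_⟩
    · rw [Nat.one_le_iff_ne_zero]
      intro h1
      have := map_some_reduceOption he
      rw [List.eq_nil_of_length_eq_zero h1] at this
      exact h0 (by rw [← this]; rfl)
    · rw [hp, List.take_left]
      have := hconf.1
      rw [List.reduceOption_append] at this
      simpa [List.reduceOption_cons_of_none, IsPerm] using this

/-! ## SIE-reducible entries and transitions -/

theorem SIEReducible.exists_eq {B : Set (List ℕ)} {c : Word} {i : ℕ} (h : SIEReducible B c i)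
    (hc : IsPerm c.reduceOption) (hv : Valid B c) :
    ∃ x v y, c = x ++ some v :: y ∧ x.length = i ∧ y ≠ [] ∧ NoAdjacentSlots (x ++ y) ∧
      delete c i = st (x ++ y) ∧ delete c i = st (keep (fun u => u != v) c) := by
  obtain ⟨x, v, y, rfl, rfl, hxy⟩ := h.1.exists_eq hc hv
  have hnodup := (isPerm_iff.1 hc).1
  have hdel := delete_eq_st_keep hnodup hxy
  refine ⟨x, v, y, rfl, rfl, ?_, hxy, by rw [hdel, keep_ne_eq hnodup], hdel⟩
  rintro rfl
  exact h.2 (by simp)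

theorem onlySlotAtEnd_st (c : Word) : OnlySlotAtEnd (st c) ↔ OnlySlotAtEnd c := by
  rw [OnlySlotAtEnd, OnlySlotAtEnd, count_none_st, st_eq_map, List.getLast?_map]
  refine and_congr_right fun _ => ?_
  rcases c.getLast? with _ | _ | _ <;> simp

/-- This is where excluding the rightmost entry matters: deleting a final number could expose a slot
at the end. -/
theorem onlySlotAtEnd_remove {x y : Word} {v : ℕ} (hy : y ≠ []) :
    OnlySlotAtEnd (x ++ some v :: y) ↔ OnlySlotAtEnd (x ++ y) := by
  obtain ⟨o, y, rfl⟩ := List.exists_cons_of_ne_nil hy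
  simp [OnlySlotAtEnd, List.getLast?_append, List.getLast?_cons_cons]

theorem SIEReducible.onlySlotAtEnd_delete_iff {B : Set (List ℕ)} {c : Word} {i : ℕ}
    (h : SIEReducible B c i) (hc : IsPerm c.reduceOption) (hv : Valid B c) :
    OnlySlotAtEnd (delete c i) ↔ OnlySlotAtEnd c := by
  obtain ⟨x, v, y, rfl, -, hy, -, hdel, -⟩ := h.exists_eq hc hv
  rw [hdel, onlySlotAtEnd_st, onlySlotAtEnd_remove hy]

theorem IEReducible.count_none_delete {B : Set (List ℕ)} {c : Word} {i : ℕ}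
    (h : IEReducible B c i) (hc : IsPerm c.reduceOption) (hv : Valid B c) :
    (delete c i).count none = c.count none :=
  (h.2.count_eq hc (isConfig_delete hc i).1 hv).symm

theorem SIEReducible.length_delete_lt {B : Set (List ℕ)} {c : Word} {i : ℕ}
    (h : SIEReducible B c i) (hc : IsPerm c.reduceOption) (hv : Valid B c) :
    (delete c i).length < c.length := by
  obtain ⟨x, v, y, rfl, -, -, -, hdel, -⟩ := h.exists_eq hc hv
  rw [hdel, length_st]
  simp

theorem Indistinguishable.valid_iff {B : Set (List ℕ)} {c d : Word}
    (h : Indistinguishable B c d) : Valid B c ↔ Valid B d := exists_congr h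

theorem SIEReducible.isKept_delete {B : Set (List ℕ)} {c : Word} {i : ℕ}
    (h : SIEReducible B c i) (hc : IsKept B c) : IsKept B (delete c i) := by
  refine ⟨isConfig_delete hc.1.1 i, h.1.2.valid_iff.1 hc.2.1, fun h' => hc.2.2 ⟨?_, ?_⟩⟩
  · obtain ⟨x, v, y, rfl, -⟩ := h.exists_eq hc.1.1 hc.2.1
    intro h0
    have : some v ∈ initial := by rw [← h0]; simp
    simp [initial] at this
  · exact (h.onlySlotAtEnd_delete_iff hc.1.1 hc.2.1).1 h'.2

theorem run_singleton (c : Word) (a : Letter) : run c [a] = step c a := by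
  simp [run]

theorem ne_initial_of_step {c d : Word} {a : Letter} (h : step c a = some d) : d ≠ initial := by
  rintro rfl
  have := length_of_step h
  simp [initial, List.reduceOption_cons_of_none] at this

/-- The same number `v`, at its possibly shifted position `i'`, stays reducible: deletion commutes
with the letter, indistinguishability passes to successors, and something still stands to the right
of `v`. -/
theorem SIEReducible.step_delete {B : Set (List ℕ)} {c c' : Word} {i : ℕ} {a : Letter}
    (h : SIEReducible B c i) (hc : IsConfig c) (hv : Valid B c) (hs : step c a = some c') :
    ∃ i', step (delete c i) a = some (delete c' i') ∧ SIEReducible B c' i' := by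
  obtain ⟨x, v, y, rfl, rfl, hy, hxy, -, hdel⟩ := h.exists_eq hc.1 hv
  have hc' := isConfig_of_step hc hs
  have hnodup := (isPerm_iff.1 hc'.1).1
  obtain ⟨E, hE, -, -, hEst, -⟩ := exists_run_st_keep (w := [a]) hc.1
    (by rwa [run_singleton]) fun u => u != v
  rw [run_singleton, ← hdel] at hE
  have hEconf := isConfig_of_step (isConfig_delete hc.1 _) hE
  have hvle : v ≤ (x ++ some v :: y).reduceOption.length :=
    ((isPerm_iff.1 hc.1).2 v (List.reduceOption_mem_iff.2 (by simp))).2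
  -- Since `v` is an old number, keeping all new numbers and all old ones except `v` means keeping
  -- everything except `v`.
  rw [keep_congr (Q := fun u => u != v) fun u _ => by
    by_cases h : u = v
    · subst h; simp; omega
    · simp [h]] at hEst
  obtain ⟨x', y', hy', rfl⟩ : ∃ x' y', y' ≠ [] ∧ c' = x' ++ some v :: y' := by
    obtain ⟨X, Y, hXY, -, rfl⟩ := step_eq_some_iff.1 hs
    generalize (x ++ some v :: y).reduceOption.length + 1 = m
    rcases List.append_eq_append_iff.1 hXY with ⟨z, rfl, hz⟩ | ⟨z, rfl, hz⟩
    · cases z with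
      | nil => simp at hz
      | cons o z =>
        obtain ⟨rfl, -⟩ := List.cons.inj hz
        exact ⟨x, z ++ (a.block m ++ Y), by cases a <;> simp [Letter.block],
          by simp only [List.append_assoc, List.cons_append]⟩
    · cases z with
      | nil => simp at hz
      | cons o z =>
        obtain ⟨rfl, rfl⟩ := List.cons.inj hz
        exact ⟨X ++ a.block m ++ z, y, hy,
          by simp only [List.append_assoc]; rfl⟩
  -- The standardization of `x' ++ y'` is the successor `E` of the configuration `delete c i`, hence
  -- itself a configuration.
  have hxy' : NoAdjacentSlots (x' ++ y') := by
    rw [← keep_ne_eq hnodup, ← noAdjacentSlots_st, ← hEst]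
    exact hEconf.2
  have hdel' := delete_eq_st_keep hnodup hxy'
  rw [← hEst] at hdel'
  refine ⟨x'.length, by rw [hdel', hE], ⟨by simp, ?_⟩, ?_⟩
  · rw [hdel']
    exact h.1.2.of_step hs hE
  · have := List.length_pos_iff.2 hy'
    simp; omega

/-! ## The quotient automaton -/

theorem SIEState.mk_eq_of_identified {B : Set (List ℕ)} {s t : Option (Kept B)}
    (h : Identified B s t) : SIEState.mk s = SIEState.mk t :=
  Quotient.sound (Relation.EqvGen.rel _ _ h)

theorem toState_of_isKept {B : Set (List ℕ)} {c : Word} (h : IsKept B c) :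
    toState B c = some ⟨c, h⟩ := dif_pos h

theorem toState_of_not_isKept {B : Set (List ℕ)} {c : Word} (h : ¬ IsKept B c) :
    toState B c = none := dif_neg h

theorem keptAutomaton_step_some {B : Set (List ℕ)} (c : Kept B) (a : Letter) :
    (keptAutomaton B).step (some c) a = (step c.1 a).bind fun d => toState B d := rfl

/-- Both transitions are undefined, or both results are discarded, or the results are again
identified. The exception made for `initial` plays no role, since no letter leads to `initial`. -/
theorem mk_step_eq_of_identified {B : Set (List ℕ)} {s t : Option (Kept B)}
    (h : Identified B s t) (a : Letter) :
    SIEState.mk ((keptAutomaton B).step s a) = SIEState.mk ((keptAutomaton B).step t a) := by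
  obtain ⟨⟨c, hc⟩, ⟨_, hd⟩, rfl, rfl, i, hi, rfl⟩ := h
  dsimp only at hi
  rw [keptAutomaton_step_some, keptAutomaton_step_some]
  dsimp only
  cases hs : step c a with
  | none =>
    obtain ⟨x, v, y, -, -, -, -, -, hdel⟩ := hi.exists_eq hc.1.1 hc.2.1
    cases hs' : step (delete c i) a with
    | none => rfl
    | some E =>
      rw [hdel, ← run_singleton] at hs'
      obtain ⟨D, hD⟩ := exists_run_of_run_st_keep hc.1.1 hs'
      simp [run_singleton, hs] at hD
  | some c' =>
    obtain ⟨i', hs', hi'⟩ := hi.step_delete hc.1 hc.2.1 hs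
    have hconf := isConfig_of_step hc.1 hs
    rw [hs', Option.bind_some, Option.bind_some]
    by_cases hk : IsKept B c'
    · rw [toState_of_isKept hk, toState_of_isKept (hi'.isKept_delete hk)]
      exact SIEState.mk_eq_of_identified ⟨_, _, rfl, rfl, i', hi', rfl⟩
    · rw [toState_of_not_isKept hk, toState_of_not_isKept]
      intro hk'
      have hv := hi'.1.2.valid_iff.2 hk'.2.1
      refine hk ⟨hconf, hv, fun h => hk'.2.2 ⟨ne_initial_of_step hs', ?_⟩⟩
      exact (hi'.onlySlotAtEnd_delete_iff hconf.1 hv).2 h.2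

theorem mk_step_eq {B : Set (List ℕ)} {s t : Option (Kept B)}
    (h : Relation.EqvGen (Identified B) s t) (a : Letter) :
    SIEState.mk ((keptAutomaton B).step s a) = SIEState.mk ((keptAutomaton B).step t a) := by
  induction h with
  | rel _ _ h => exact mk_step_eq_of_identified h a
  | refl => rfl
  | symm _ _ _ ih => exact ih.symm
  | trans _ _ _ _ _ ih1 ih2 => exact ih1.trans ih2

theorem mem_accept_iff {B : Set (List ℕ)} {s t : Option (Kept B)}
    (h : Relation.EqvGen (Identified B) s t) :
    s ∈ (keptAutomaton B).accept ↔ t ∈ (keptAutomaton B).accept := by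
  induction h with
  | rel _ _ h =>
    obtain ⟨c, d, rfl, rfl, i, hi, hd⟩ := h
    have := hi.1.count_none_delete c.2.1.1 c.2.2.1
    rw [← hd] at this
    have h1 : ∀ e : Kept B, some e ∈ (keptAutomaton B).accept ↔ e.1.count none = 0 := by
      intro e
      rw [List.count_eq_zero]
      exact ⟨by rintro ⟨_, h, he⟩; cases h; exact he, fun h => ⟨e, rfl, h⟩⟩
    rw [h1, h1, this]
  | refl => rfl
  | symm _ _ _ ih => exact ih.symm
  | trans _ _ _ _ _ ih1 ih2 => exact ih1.trans ih2

/-- Each identification of a long state shortens it within its class, so every class contains the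
dead state or a state of length at most `N`. -/
theorem finite_sieState {B : Set (List ℕ)} {N : ℕ}
    (hN : ∀ c : Word, IsConfig c → Valid B c → N ≤ c.length → ∃ i, SIEReducible B c i) :
    Finite (SIEState B) := by
  have hfin : Finite {c : Kept B // c.1.length ≤ N} := by
    have := (finite_setOf_words N).to_subtype
    refine Finite.of_injective (β := {c : Word | IsPerm c.reduceOption ∧ c.length ≤ N})
      (fun c => ⟨c.1.1, c.1.2.1.1, c.2⟩) fun c d h => ?_
    exact Subtype.ext (Subtype.ext (by simpa using h))
  refine Finite.of_surjective
    (fun s : Option {c : Kept B // c.1.length ≤ N} => SIEState.mk (s.map Subtype.val)) fun q => ?_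
  obtain ⟨s, rfl⟩ := Quotient.exists_rep q
  change ∃ t, _ = SIEState.mk s
  cases s with
  | none => exact ⟨none, rfl⟩
  | some c =>
    induction hn : c.1.length using Nat.strong_induction_on generalizing c with
    | _ n ih =>
    by_cases hc : c.1.length ≤ N
    · exact ⟨some ⟨c, hc⟩, rfl⟩
    · obtain ⟨i, hi⟩ := hN c.1 c.2.1 c.2.2.1 (by omega)
      obtain ⟨t, ht⟩ := ih _ (hn ▸ hi.length_delete_lt c.2.1.1 c.2.2.1)
        ⟨delete c.1 i, hi.isKept_delete c.2⟩ rfl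
      exact ⟨t, ht.trans (SIEState.mk_eq_of_identified ⟨_, _, rfl, rfl, i, hi, rfl⟩).symm⟩

/-! ## The language of the automaton of remaining configurations -/

theorem evalFrom_none_notMem {B : Set (List ℕ)} (w : List Letter) :
    (keptAutomaton B).evalFrom none w ∉ (keptAutomaton B).accept := by
  induction w with
  | nil => rintro ⟨c, h, -⟩; cases h
  | cons a w ih => exact ih

/-- The dead state absorbs, so acceptance means acceptance in the full automaton along a run
avoiding the discarded configurations. Validity along the run is automatic, witnessed by the rest of
the word. -/
theorem evalFrom_mem_accept_iff {B : Set (List ℕ)} (c : Kept B) (w : List Letter) :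
    (keptAutomaton B).evalFrom (some c) w ∈ (keptAutomaton B).accept ↔
      AcceptsFrom B c.1 w ∧ ∀ u v, w = u ++ v → ∀ e, run c.1 u = some e →
        ¬ (e ≠ initial ∧ OnlySlotAtEnd e) := by
  induction w generalizing c with
  | nil =>
    constructor
    · rintro ⟨_, h, hc⟩
      obtain rfl := Option.some.inj h
      constructor
      -- A slotless state is valid, and its shortest accepted word has length zero, so it already is
      -- an element of `Av B`.
      · obtain ⟨u, hu⟩ := c.2.2.1
        obtain ⟨v, hv, hacc⟩ := exists_acceptsFrom_length_eq c.2.1.1 hu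
        rw [List.count_eq_zero.2 hc] at hv
        rwa [List.eq_nil_of_length_eq_zero hv] at hacc
      · rintro u v huv e he
        obtain ⟨rfl, rfl⟩ := List.append_eq_nil_iff.1 huv.symm
        cases he
        exact c.2.2.2
    · rintro ⟨h, -⟩
      obtain ⟨p, -, hp⟩ := acceptsFrom_nil.1 h
      exact ⟨c, rfl, hp ▸ none_notMem_ofPerm p⟩
  | cons a w ih =>
    rw [DFA.evalFrom_cons, keptAutomaton_step_some, acceptsFrom_cons]
    cases hs : step c.1 a with
    | none =>
      exact iff_of_false (evalFrom_none_notMem w) (by simp)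
    | some d =>
      rw [Option.bind_some]
      by_cases hk : IsKept B d
      · rw [toState_of_isKept hk, ih]
        refine and_congr (by simp) ⟨fun h u v huv e he => ?_, fun h u v huv e he => ?_⟩
        · cases u with
          | nil => cases he; exact c.2.2.2
          | cons b u =>
            obtain ⟨rfl, rfl⟩ := List.cons.inj huv
            refine h u v rfl e ?_
            simpa [run, hs] using he
        · exact h (a :: u) v (by rw [huv]; rfl) e (by simpa [run, hs] using he)
      · rw [toState_of_not_isKept hk]
        refine iff_of_false (evalFrom_none_notMem w) ?_
        rintro ⟨⟨_, hd, hacc⟩, h⟩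
        obtain rfl := Option.some.inj hd
        exact hk ⟨isConfig_of_step c.2.1 hs, ⟨w, hacc⟩, h [a] w rfl d (by rw [run_singleton, hs])⟩

theorem accepts_keptAutomaton (B : Set (List ℕ)) :
    (keptAutomaton B).accepts = insertionEncoding {p | p ∈ Av B ∧ SumIndecomposable p} := by
  ext w
  have hmem : w ∈ insertionEncoding {p | p ∈ Av B ∧ SumIndecomposable p} ↔
      AcceptsFrom B initial w ∧ ∀ u v, w = u ++ v → ∀ e, run initial u = some e →
        ¬ (e ≠ initial ∧ OnlySlotAtEnd e) := by
    constructor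
    · rintro ⟨p, ⟨hp, hsum⟩, h⟩
      exact ⟨⟨p, hp, h⟩, (sumIndecomposable_iff h).1 hsum⟩
    · rintro ⟨⟨p, hp, h⟩, hw⟩
      exact ⟨p, ⟨hp, (sumIndecomposable_iff h).2 hw⟩, h⟩
  rw [hmem]
  change (keptAutomaton B).evalFrom (toState B initial) w ∈ (keptAutomaton B).accept ↔ _
  by_cases hk : IsKept B initial
  · rw [toState_of_isKept hk, evalFrom_mem_accept_iff]
  · rw [toState_of_not_isKept hk]
    refine iff_of_false (evalFrom_none_notMem w) fun h => hk ⟨isConfig_initial, ⟨w, h.1⟩, ?_⟩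
    exact fun h => h.1 rfl

/-- The quotient of the automaton of remaining configurations. -/
noncomputable def sieAutomaton (B : Set (List ℕ)) : DFA Letter (SIEState B) where
  step q a := Quotient.lift (fun s => SIEState.mk ((keptAutomaton B).step s a))
    (fun _ _ h => mk_step_eq h a) q
  start := SIEState.mk (keptAutomaton B).start
  accept := SIEState.mk '' (keptAutomaton B).accept

theorem sieAutomaton_evalFrom (B : Set (List ℕ)) (s : Option (Kept B)) (w : List Letter) :
    (sieAutomaton B).evalFrom (SIEState.mk s) w =
      SIEState.mk ((keptAutomaton B).evalFrom s w) := by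
  induction w generalizing s with
  | nil => rfl
  | cons a w ih => exact ih _

theorem accepts_sieAutomaton (B : Set (List ℕ)) :
    (sieAutomaton B).accepts = insertionEncoding {p | p ∈ Av B ∧ SumIndecomposable p} := by
  rw [← accepts_keptAutomaton]
  ext w
  change (sieAutomaton B).evalFrom (SIEState.mk (keptAutomaton B).start) w ∈
    (sieAutomaton B).accept ↔ _
  rw [sieAutomaton_evalFrom]
  constructor
  · rintro ⟨s, hs, h⟩
    exact (mem_accept_iff (Quotient.exact h)).1 hs
  · exact fun h => ⟨_, h, rfl⟩

end InsEnc

/-- Let `B` be a finite set of permutations such that `Av(B)` has a regular insertion encoding.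
Then the insertion encoding of the sum indecomposable elements of `Av(B)` is regular, and it uses
only finitely many letters.  Every sufficiently long valid configuration has an SIE-reducible
entry.  The transitions of the automaton of remaining configurations pass to the classes under the
identifications of `c` with `st(c - c(i))` for `c(i)` SIE-reducible, and the resulting automaton is
finite and accepts this insertion encoding. -/
theorem mainTheorem3 (B : Set (List ℕ)) (hfin : B.Finite) (hperm : ∀ b ∈ B, InsEnc.IsPerm b)
    (hreg : (InsEnc.insertionEncoding (InsEnc.Av B)).IsRegular) :
    (InsEnc.insertionEncoding {p | p ∈ InsEnc.Av B ∧ InsEnc.SumIndecomposable p}).IsRegular ∧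
    {a : InsEnc.Letter | ∃ w ∈ InsEnc.insertionEncoding
        {p | p ∈ InsEnc.Av B ∧ InsEnc.SumIndecomposable p}, a ∈ w}.Finite ∧
    (∃ N : ℕ, ∀ c : InsEnc.Word, InsEnc.IsConfig c → InsEnc.Valid B c → N ≤ c.length →
      ∃ i : ℕ, InsEnc.SIEReducible B c i) ∧
    Finite (InsEnc.SIEState B) ∧
    ∃ M : DFA InsEnc.Letter (InsEnc.SIEState B),
      M.start = InsEnc.SIEState.mk (InsEnc.keptAutomaton B).start ∧
      (∀ (s : Option (InsEnc.Kept B)) (a : InsEnc.Letter),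
        M.step (InsEnc.SIEState.mk s) a =
          InsEnc.SIEState.mk ((InsEnc.keptAutomaton B).step s a)) ∧
      M.accept = InsEnc.SIEState.mk '' (InsEnc.keptAutomaton B).accept ∧
      M.accepts = InsEnc.insertionEncoding
        {p | p ∈ InsEnc.Av B ∧ InsEnc.SumIndecomposable p} := by
  obtain ⟨K, hK⟩ := InsEnc.exists_count_none_le hreg
  obtain ⟨N, hN⟩ := InsEnc.exists_sieReducible_of_count_le hfin K
  have hN' : ∀ c : InsEnc.Word, InsEnc.IsConfig c → InsEnc.Valid B c → N ≤ c.length →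
      ∃ i : ℕ, InsEnc.SIEReducible B c i := fun c hc hv => hN c hc (hK c hc hv)
  have hQ : Finite (InsEnc.SIEState B) := InsEnc.finite_sieState hN'
  refine ⟨⟨_, Fintype.ofFinite _, InsEnc.sieAutomaton B, InsEnc.accepts_sieAutomaton B⟩, ?_,
    ⟨N, hN'⟩, hQ, InsEnc.sieAutomaton B, rfl, fun _ _ => rfl, rfl,
    InsEnc.accepts_sieAutomaton B⟩
  refine (InsEnc.finite_letters K).subset ?_
  rintro a ⟨w, ⟨p, hp, h⟩, ha⟩
  exact InsEnc.index_le_of_acceptsFrom hK InsEnc.isConfig_initial ⟨p, hp.1, h⟩ a ha
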